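/- Let $q \ge 3$ and $a$ be integers with $(a,q)=1$; $p$ always denotes a prime, $\varphi$ is Euler's function, $\mu$ the Möbius function and $\gamma$ Euler's constant. Let $C(q,a)>0$ be the constant defined by $$\prod_{\substack{p\le x\\ p\equiv a \bmod q}}\Bigl(1-\frac1p\Bigr)=\frac{C(q,a)}{(\log x)^{1/\varphi(q)}}\,(1+o(1))\qquad(x\to+\infty).$$ Put $\alpha(p;q,a)=\varphi(q)-1$ if $p\equiv a \bmod q$ and $\alpha(p;q,a)=-1$ otherwise. For a Dirichlet character $\chi$ modulo $q$ and $B>0$ write $$L_B(\chi,s)=\prod_{p>B}\Bigl(1-\frac{\chi(p)}{p^s}\Bigr)^{-1},\qquad \log L_B(\chi,s)=-\sum_{p>B}\log\Bigl(1-\frac{\chi(p)}{p^s}\Bigr),$$ with principal logarithms on the right, and with product and sum taken in increasing order of $p$. Let $A>0$ be a real number such that every prime divisor of $q$ is at most $Aq$ (for instance any $A\ge 1$). Then the constant $C(q,a)$ exists; for every non-principal character $\chi$ modulo $q$ and all integers $k,m\ge1$ the product $L_{Aq}(\chi^k,km)$ and the sum $\log L_{Aq}(\chi^k,km)$ converge,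 and the latter is a logarithm of the former; the series over $k$ below, and then the series over $m$, converge absolutely; and $$\varphi(q)\log C(q,a)=-\gamma+\log\prod_{p\le Aq}\Bigl(1-\frac1p\Bigr)^{\alpha(p;q,a)}-\sum_{\substack{\chi \bmod q\\ \chi\ne\chi_0}}\overline{\chi}(a)\sum_{m\ge1}\frac1m\sum_{k\ge1}\frac{\mu(k)}{k}\log L_{Aq}(\chi^k,km),$$ where $\chi_0$ is the principal character modulo $q$. -/

import Mathlib

open Filter Topology Asymptotics

noncomputable section

/-- The finite set of primes `p ≤ x`, for a real number `x`. -/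
def primesUpTo (x : ℝ) : Finset ℕ :=
  (Finset.Iic ⌊x⌋₊).filter Nat.Prime

/-- The partial Mertens product `P(x; q, a) = ∏_{p ≤ x, p ≡ a mod q} (1 - 1/p)`. -/
def mertensProd (q : ℕ) (a : ℤ) (x : ℝ) : ℝ :=
  ∏ p ∈ (primesUpTo x).filter (fun p : ℕ => (p : ℤ) ≡ a [ZMOD (q : ℤ)]), (1 - 1 / (p : ℝ))

/-- The constant `C(q, a)`, that is `lim_{x → ∞} P(x; q, a) (log x)^{1/φ(q)}`. -/
def mertensConst (q : ℕ) (a : ℤ) : ℝ :=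
  limUnder atTop
    (fun x : ℝ => mertensProd q a x * (Real.log x) ^ (1 / (Nat.totient q : ℝ)))

/-- The exponent `α(p; q, a)`: `φ(q) - 1` if `p ≡ a mod q`, and `-1` otherwise. -/
def mertensExp (q : ℕ) (a : ℤ) (p : ℕ) : ℤ :=
  if (p : ℤ) ≡ a [ZMOD (q : ℤ)] then (Nat.totient q : ℤ) - 1 else -1

/-- The partial Euler product `∏_{B < p ≤ N} (1 - χ(p) p^{-s})⁻¹`. -/
def eulerTailPartial {q : ℕ} (χ : DirichletCharacter ℂ q) (B : ℝ) (s : ℂ) (N : ℕ) : ℂ :=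
  ∏ p ∈ (Finset.Iic N).filter (fun p : ℕ => p.Prime ∧ B < (p : ℝ)),
    (1 - χ (p : ZMod q) / (p : ℂ) ^ s)⁻¹

/-- `L_B(χ, s) = ∏_{p > B} (1 - χ(p) p^{-s})⁻¹`, the limit of the partial products taken in
increasing order of `p` (the convergence is only conditional at `s = 1`). -/
def eulerTail {q : ℕ} (χ : DirichletCharacter ℂ q) (B : ℝ) (s : ℂ) : ℂ :=
  limUnder atTop (eulerTailPartial χ B s)

/-- The partial sum `-∑_{B < p ≤ N} Log (1 - χ(p) p^{-s})`, with principal logarithms. -/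
def logEulerTailPartial {q : ℕ} (χ : DirichletCharacter ℂ q) (B : ℝ) (s : ℂ) (N : ℕ) : ℂ :=
  -∑ p ∈ (Finset.Iic N).filter (fun p : ℕ => p.Prime ∧ B < (p : ℝ)),
    Complex.log (1 - χ (p : ZMod q) / (p : ℂ) ^ s)

/-- The logarithm `log L_B(χ, s) = -∑_{p > B} Log (1 - χ(p) p^{-s})` given by the Euler product.
It is the branch with `log L_B(χ, s) = ∑_{p > B} ∑_{j ≥ 1} χ(p)^j / (j p^{js})`. -/
def logEulerTail {q : ℕ} (χ : DirichletCharacter ℂ q) (B : ℝ) (s : ℂ) : ℂ :=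
  limUnder atTop (logEulerTailPartial χ B s)

/-- The term `(μ(k)/k) log L_B(χ^k, km)`. -/
def moebiusTerm {q : ℕ} (χ : DirichletCharacter ℂ q) (B : ℝ) (m k : ℕ+) : ℂ :=
  ((ArithmeticFunction.moebius (k : ℕ) : ℤ) : ℂ) / ((k : ℕ) : ℂ) *
    logEulerTail (χ ^ (k : ℕ)) B (((k : ℕ) * (m : ℕ) : ℕ) : ℂ)

end

/-!
Write `P(x)` for the product defining `C(q, a)`. Since `φ(q)` times the indicator of `p ≡ a` is
`α(p; q, a) + 1`, the number `φ(q) log P(x)` is the sum of `∑_{p ≤ x} log (1 - 1/p)`, which is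
`-log log x - γ + o(1)` by Mertens' third theorem, and of `∑_{p ≤ x} α(p; q, a) log (1 - 1/p)`.
For `p ∤ q`, orthogonality gives `α(p; q, a) = ∑_{χ ≠ χ₀} conj (χ a) χ(p)`, so what remains is to
evaluate `-∑_{p > B} χ(p) log (1 - 1/p) = ∑_m (1/m) ∑_{p > B} χ(p) / p ^ m` for non-principal `χ`.
Möbius inversion in the form `z = -∑_k (μ(k) / k) log (1 - z ^ k)`, applied to `z = χ(p) / p ^ m`,
turns the sum over `p` into `∑_k (μ(k) / k) log L_B(χ ^ k, k m)`; bounds on the partial products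
that are uniform in the number of primes allow the limit to be taken inside both series.

Convergence on the line `s = 1` comes from `Λ * 1 = log` twisted by `χ` together with
`L(χ, 1) ≠ 0`, followed by partial summation. The constant `γ` in Mertens' third theorem comes from
an Abelian theorem for Laplace transforms: the point masses `1/p` at `log p` and `1/n` at `n` have
distribution functions with a common asymptotic up to a constant, and the transform of the first is
governed by `ζ(1 + s)` as `s → 0⁺`.
-/

/-! ### Abel summation -/

section AbelSummation

variable {E : Type*} [NormedAddCommGroup E] {f : ℕ → ℝ} {z : ℕ → E} {b : ℝ}

theorem norm_sum_range_add_le (hz : ∀ n, ‖∑ i ∈ Finset.range n, z i‖ ≤ b) (k n : ℕ) :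
    ‖∑ i ∈ Finset.range n, z (k + i)‖ ≤ 2 * b := by
  rw [eq_sub_of_add_eq' (Finset.sum_range_add z k n).symm, two_mul]
  exact (norm_sub_le _ _).trans (add_le_add (hz _) (hz _))

theorem antitone_comp_add {α : Type*} [Preorder α] {g : ℕ → α} {k : ℕ}
    (hg : AntitoneOn g (Set.Ici k)) : Antitone fun i => g (k + i) := fun i j hij =>
  hg (Nat.le_add_right k i) (Nat.le_add_right k j) (Nat.add_le_add_left hij k)

variable [NormedSpace ℝ E]

theorem norm_sum_range_smul_le_of_antitone (hf : Antitone f) (hf0 : ∀ n, 0 ≤ f n)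
    (hz : ∀ n, ‖∑ i ∈ Finset.range n, z i‖ ≤ b) (n : ℕ) :
    ‖∑ i ∈ Finset.range n, f i • z i‖ ≤ b * f 0 := by
  have hstep (i : ℕ) : ‖(f (i + 1) - f i) • ∑ j ∈ Finset.range (i + 1), z j‖
      ≤ (f i - f (i + 1)) * b := by
    have h := sub_nonneg.2 (hf (Nat.le_succ i))
    rw [← neg_sub, neg_smul, norm_neg, norm_smul, Real.norm_of_nonneg h]
    exact mul_le_mul_of_nonneg_left (hz _) h
  rw [Finset.sum_range_by_parts]
  calc _ ≤ f (n - 1) * b + ∑ i ∈ Finset.range (n - 1), (f i - f (i + 1)) * b := by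
        refine (norm_sub_le _ _).trans (add_le_add ?_ (norm_sum_le_of_le _ fun i _ => hstep i))
        rw [norm_smul, Real.norm_of_nonneg (hf0 _)]
        exact mul_le_mul_of_nonneg_left (hz n) (hf0 _)
    _ = b * f 0 := by
        rw [← Finset.sum_mul, Finset.sum_range_sub']
        ring

theorem norm_lim_sub_sum_range_smul_le {k : ℕ} (hf : AntitoneOn f (Set.Ici k))
    (hf0 : ∀ n, 0 ≤ f n) (hz : ∀ n, ‖∑ i ∈ Finset.range n, z i‖ ≤ b) {l : E}
    (hl : Tendsto (fun n => ∑ i ∈ Finset.range n, f i • z i) atTop (𝓝 l)) :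
    ‖l - ∑ i ∈ Finset.range k, f i • z i‖ ≤ 2 * b * f k := by
  refine le_of_tendsto (((tendsto_add_atTop_iff_nat k).2 hl).sub_const _).norm
    (Eventually.of_forall fun n => ?_)
  rw [add_comm n k, Finset.sum_range_add, add_sub_cancel_left]
  exact norm_sum_range_smul_le_of_antitone (antitone_comp_add hf) (fun _ => hf0 _)
    (norm_sum_range_add_le hz k) n

theorem exists_tendsto_sum_range_smul_of_antitoneOn [CompleteSpace E] {k : ℕ}
    (hf : AntitoneOn f (Set.Ici k)) (hf0 : Tendsto f atTop (𝓝 0))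
    (hz : ∀ n, ‖∑ i ∈ Finset.range n, z i‖ ≤ b) :
    ∃ l, Tendsto (fun n => ∑ i ∈ Finset.range n, f i • z i) atTop (𝓝 l) := by
  have hshift : Tendsto (fun i => f (k + i)) atTop (𝓝 0) := by
    simpa only [add_comm k] using (tendsto_add_atTop_iff_nat k).2 hf0
  obtain ⟨l, hl⟩ := cauchySeq_tendsto_of_complete
    ((antitone_comp_add hf).cauchySeq_series_mul_of_tendsto_zero_of_bounded hshift
      (norm_sum_range_add_le hz k))
  refine ⟨∑ i ∈ Finset.range k, f i • z i + l, (tendsto_add_atTop_iff_nat k).1 ?_⟩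
  exact (hl.const_add _).congr fun n => by rw [add_comm n k, Finset.sum_range_add]

end AbelSummation

/-! ### Sums of non-principal characters -/

section CharacterSums

variable {q : ℕ} [NeZero q] {χ : DirichletCharacter ℂ q}

theorem sum_range_char_eq_zero (hχ : χ ≠ 1) : ∑ n ∈ Finset.range q, χ (n : ZMod q) = 0 := by
  rw [← MulChar.sum_eq_zero_of_ne_one hχ]
  refine Finset.sum_nbij' (fun n : ℕ => (n : ZMod q)) ZMod.val ?_ ?_ ?_ ?_ ?_
  · simp
  · intro a _
    simpa using ZMod.val_lt a
  · intro n hn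
    simpa using ZMod.val_cast_of_lt (Finset.mem_range.1 hn)
  · simp
  · simp

theorem norm_sum_range_char_le (hχ : χ ≠ 1) (N : ℕ) :
    ‖∑ n ∈ Finset.range N, χ (n : ZMod q)‖ ≤ q := by
  induction N using Nat.strong_induction_on with
  | _ N ih =>
    rcases lt_or_ge N q with h | h
    · refine (norm_sum_le_of_le (Finset.range N) fun n _ => χ.norm_le_one (n : ZMod q)).trans ?_
      simpa using h.le
    · obtain ⟨M, rfl⟩ := Nat.exists_eq_add_of_le h
      rw [Finset.sum_range_add, sum_range_char_eq_zero hχ, zero_add]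
      simpa using ih M (by have := NeZero.pos q; omega)

theorem rpow_neg_natCast_smul (σ : ℝ) (n : ℕ) (w : ℂ) :
    (n : ℝ) ^ (-σ) • w = w * (n : ℂ) ^ (-σ : ℂ) := by
  rw [Complex.real_smul, Complex.ofReal_cpow n.cast_nonneg, mul_comm]
  simp

theorem norm_LFunction_sub_sum_le {σ : ℝ} (hσ : 1 < σ) (hχ : χ ≠ 1) (N : ℕ) :
    ‖DirichletCharacter.LFunction χ σ -
      ∑ n ∈ Finset.range (N + 1), χ (n : ZMod q) * (n : ℂ) ^ (-σ : ℂ)‖ ≤ 2 * q / (N + 1) := by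
  have hre : 1 < (σ : ℂ).re := by simpa using hσ
  have hσ0 : (σ : ℂ) ≠ 0 := by
    exact_mod_cast (one_pos.trans hσ).ne'
  have hanti : AntitoneOn (fun n : ℕ => (n : ℝ) ^ (-σ)) (Set.Ici (N + 1)) := fun i hi j _ hij => by
    have : (0 : ℝ) < i := by exact_mod_cast N.succ_pos.trans_le hi
    exact Real.rpow_le_rpow_of_nonpos this (by exact_mod_cast hij) (by linarith)
  have hsum : Tendsto (fun M => ∑ n ∈ Finset.range M, (n : ℝ) ^ (-σ) • χ (n : ZMod q)) atTop
      (𝓝 (DirichletCharacter.LFunction χ σ)) := by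
    rw [DirichletCharacter.LFunction_eq_LSeries χ hre]
    refine (DirichletCharacter.LSeriesSummable_of_one_lt_re χ hre).LSeriesHasSum
      |>.tendsto_sum_nat.congr fun M => Finset.sum_congr rfl fun n _ => ?_
    rw [LSeries.term_of_ne_zero' hσ0, rpow_neg_natCast_smul, Complex.cpow_neg, div_eq_mul_inv]
  have htail := norm_lim_sub_sum_range_smul_le hanti (fun n => by positivity)
    (norm_sum_range_char_le hχ) hsum
  simp only [rpow_neg_natCast_smul] at htail
  refine htail.trans ?_
  rw [div_eq_mul_inv]
  gcongr
  push_cast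
  rw [← Real.rpow_neg_one]
  exact Real.rpow_le_rpow_of_exponent_le (by simp) (by linarith)

theorem norm_LFunction_one_sub_sum_le (hχ : χ ≠ 1) (N : ℕ) :
    ‖DirichletCharacter.LFunction χ 1 - ∑ n ∈ Finset.range (N + 1), χ (n : ZMod q) / n‖
      ≤ 2 * q / (N + 1) := by
  have hcont : ContinuousAt (fun σ : ℝ => DirichletCharacter.LFunction χ σ -
      ∑ n ∈ Finset.range (N + 1), χ (n : ZMod q) * (n : ℂ) ^ (-σ : ℂ)) 1 := by
    refine ContinuousAt.sub ?_ (tendsto_finsetSum _ fun n _ => ?_)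
    · exact (DirichletCharacter.differentiable_LFunction hχ).continuous.continuousAt.comp
        Complex.continuous_ofReal.continuousAt
    · exact continuousAt_const.mul (ContinuousAt.const_cpow (by fun_prop) (Or.inr (by simp)))
  have hlim := hcont.tendsto.mono_left (nhdsWithin_le_nhds (s := Set.Ioi 1))
  simp only [Complex.ofReal_one, Complex.cpow_neg_one, ← div_eq_mul_inv] at hlim
  exact le_of_tendsto hlim.norm
    (eventually_mem_nhdsWithin.mono fun σ hσ => norm_LFunction_sub_sum_le hσ hχ N)

end CharacterSums

/-! ### Mertens' first theorem, plain and twisted -/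

section MertensFirst

open scoped ArithmeticFunction.vonMangoldt

theorem sum_Ioc_zero_eq_sum_range {M : Type*} [AddCommMonoid M] {f : ℕ → M} (h : f 0 = 0) (N : ℕ) :
    ∑ n ∈ Finset.Ioc 0 N, f n = ∑ n ∈ Finset.range (N + 1), f n := by
  rw [Nat.range_succ_eq_Icc_zero, ← Finset.add_sum_Ioc_eq_sum_Icc N.zero_le, h, zero_add]

theorem natCast_div_le_natDiv_add_one (N d : ℕ) : (N : ℝ) / d ≤ (N / d : ℕ) + 1 := by
  rw [← Nat.floor_div_eq_div (K := ℝ)]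
  exact (Nat.lt_floor_add_one _).le

theorem sum_Ioc_vonMangoldt_le (N : ℕ) : ∑ n ∈ Finset.Ioc 0 N, Λ n ≤ (Real.log 4 + 4) * N := by
  simpa [Chebyshev.psi] using Chebyshev.psi_le_const_mul_self N.cast_nonneg

theorem sum_Ioc_log_smul_eq {R : Type*} [CommRing R] [Algebra ℝ R] {c : ℕ → R}
    (hc : ∀ m n, c (m * n) = c m * c n) (N : ℕ) :
    ∑ n ∈ Finset.Ioc 0 N, Real.log n • c n =
      ∑ d ∈ Finset.Ioc 0 N, Λ d • c d * ∑ m ∈ Finset.Ioc 0 (N / d), c m := by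
  let f : ArithmeticFunction R := ⟨fun n => Λ n • c n, by simp⟩
  let g : ArithmeticFunction R := ⟨fun n => if n = 0 then 0 else c n, by simp⟩
  have hfg (n : ℕ) : (f * g) n = Real.log n • c n := by
    rw [ArithmeticFunction.mul_apply, ← ArithmeticFunction.vonMangoldt_sum,
      ← Nat.sum_divisorsAntidiagonal (fun i _ => Λ i), Finset.sum_smul]
    refine Finset.sum_congr rfl fun x hx => ?_
    obtain ⟨hmul, hn⟩ := Nat.mem_divisorsAntidiagonal.1 hx
    rw [← hmul] at hn ⊢
    simp [f, g, hc, right_ne_zero_of_mul hn]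
  have hg (M : ℕ) : ∑ m ∈ Finset.Ioc 0 M, g m = ∑ m ∈ Finset.Ioc 0 M, c m :=
    Finset.sum_congr rfl fun m hm => if_neg (Finset.mem_Ioc.1 hm).1.ne'
  calc ∑ n ∈ Finset.Ioc 0 N, Real.log n • c n = ∑ n ∈ Finset.Ioc 0 N, (f * g) n := by
        simp only [hfg]
    _ = _ := by
        simp only [ArithmeticFunction.sum_Ioc_mul_eq_sum_sum, hg]
        rfl

theorem log_factorial_eq_sum_vonMangoldt (N : ℕ) :
    Real.log N.factorial = ∑ d ∈ Finset.Ioc 0 N, Λ d * (N / d : ℕ) := by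
  have h := sum_Ioc_log_smul_eq (R := ℝ) (c := fun _ => 1) (by simp) N
  simp only [smul_eq_mul, mul_one, Finset.sum_const, Nat.card_Ioc, tsub_zero, nsmul_eq_mul] at h
  rw [← h, ← Finset.prod_Ico_id_eq_factorial, Nat.cast_prod, Real.log_prod]
  · rfl
  · exact fun n hn => by exact_mod_cast (Nat.one_le_iff_ne_zero.1 (Finset.mem_Ico.1 hn).1)

theorem log_factorial_le (N : ℕ) : Real.log N.factorial ≤ N * Real.log N := by
  rw [← Real.log_pow]
  exact Real.log_le_log (by exact_mod_cast N.factorial_pos) (by exact_mod_cast N.factorial_le_pow)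

theorem log_factorial_le_mul_sum_vonMangoldt_div (N : ℕ) :
    Real.log N.factorial ≤ N * ∑ n ∈ Finset.Ioc 0 N, Λ n / n := by
  rw [log_factorial_eq_sum_vonMangoldt, Finset.mul_sum]
  refine Finset.sum_le_sum fun d _ => ?_
  rw [mul_div_left_comm]
  exact mul_le_mul_of_nonneg_left Nat.cast_div_le ArithmeticFunction.vonMangoldt_nonneg

theorem mul_sum_vonMangoldt_div_le_log_factorial_add (N : ℕ) :
    N * ∑ n ∈ Finset.Ioc 0 N, Λ n / n ≤ Real.log N.factorial + ∑ n ∈ Finset.Ioc 0 N, Λ n := by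
  rw [log_factorial_eq_sum_vonMangoldt, Finset.mul_sum, ← Finset.sum_add_distrib]
  refine Finset.sum_le_sum fun d _ => ?_
  rw [mul_div_left_comm, ← mul_add_one]
  exact mul_le_mul_of_nonneg_left (natCast_div_le_natDiv_add_one N d)
    ArithmeticFunction.vonMangoldt_nonneg

theorem abs_sum_vonMangoldt_div_sub_log_le (N : ℕ) :
    |∑ n ∈ Finset.Ioc 0 N, Λ n / n - Real.log N| ≤ Real.log 4 + 4 := by
  have h4 : 0 ≤ Real.log 4 := Real.log_nonneg (by norm_num)
  rcases N.eq_zero_or_pos with rfl | hN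
  · simpa using by linarith
  have hN' : (0 : ℝ) < N := by exact_mod_cast hN
  have hstirling := Stirling.le_log_factorial_stirling hN.ne'
  have hlog : 0 ≤ Real.log N := Real.log_natCast_nonneg N
  have hpi : 0 ≤ Real.log (2 * Real.pi) := Real.log_nonneg (by linarith [Real.pi_gt_three])
  rw [abs_le]
  constructor <;> refine le_of_mul_le_mul_left ?_ hN'
  · nlinarith [log_factorial_le_mul_sum_vonMangoldt_div N]
  · nlinarith [mul_sum_vonMangoldt_div_le_log_factorial_add N, sum_Ioc_vonMangoldt_le N,
      log_factorial_le N]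

section Twisted

variable {𝕜 : Type*} [NormedField 𝕜] [NormedAlgebra ℝ 𝕜] {c : ℕ → 𝕜} {L : 𝕜} {A : ℝ}

theorem norm_sum_vonMangoldt_smul_mul_sub_le (hc : ∀ n, ‖c n‖ ≤ (n : ℝ)⁻¹)
    (hL : ∀ M : ℕ, ‖L - ∑ m ∈ Finset.Ioc 0 M, c m‖ ≤ A / (M + 1)) (N : ℕ) :
    ‖∑ d ∈ Finset.Ioc 0 N, Λ d • c d * (L - ∑ m ∈ Finset.Ioc 0 (N / d), c m)‖
      ≤ (Real.log 4 + 4) * A := by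
  have hA : 0 ≤ A := by simpa using (norm_nonneg _).trans (hL 0)
  rcases N.eq_zero_or_pos with rfl | hN
  · have : 0 ≤ Real.log 4 := Real.log_nonneg (by norm_num)
    simpa using by positivity
  have : (0 : ℝ) < N := by exact_mod_cast hN
  have hterm (d : ℕ) (hd : d ∈ Finset.Ioc 0 N) :
      ‖Λ d • c d * (L - ∑ m ∈ Finset.Ioc 0 (N / d), c m)‖ ≤ Λ d * (A / N) := by
    have hd' : (0 : ℝ) < d := by exact_mod_cast (Finset.mem_Ioc.1 hd).1
    rw [norm_mul, norm_smul, Real.norm_of_nonneg ArithmeticFunction.vonMangoldt_nonneg, mul_assoc]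
    refine mul_le_mul_of_nonneg_left ?_ ArithmeticFunction.vonMangoldt_nonneg
    calc ‖c d‖ * ‖L - ∑ m ∈ Finset.Ioc 0 (N / d), c m‖ ≤ (d : ℝ)⁻¹ * (A / (N / d)) := by
          refine mul_le_mul (hc d) ((hL _).trans ?_) (norm_nonneg _) (by positivity)
          gcongr
          exact natCast_div_le_natDiv_add_one N d
      _ = A / N := by field_simp
  calc _ ≤ ∑ d ∈ Finset.Ioc 0 N, Λ d * (A / N) := norm_sum_le_of_le _ hterm
    _ ≤ (Real.log 4 + 4) * N * (A / N) := by
        rw [← Finset.sum_mul]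
        gcongr
        exact sum_Ioc_vonMangoldt_le N
    _ = (Real.log 4 + 4) * A := by field_simp

theorem norm_sum_vonMangoldt_smul_le {C : ℝ} (hmul : ∀ m n, c (m * n) = c m * c n)
    (hc : ∀ n, ‖c n‖ ≤ (n : ℝ)⁻¹) (hL0 : L ≠ 0)
    (hL : ∀ M : ℕ, ‖L - ∑ m ∈ Finset.Ioc 0 M, c m‖ ≤ A / (M + 1)) {N : ℕ}
    (hlog : ‖∑ n ∈ Finset.Ioc 0 N, Real.log n • c n‖ ≤ C) :
    ‖∑ n ∈ Finset.Ioc 0 N, Λ n • c n‖ ≤ (C + (Real.log 4 + 4) * A) / ‖L‖ := by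
  have hsplit : (∑ n ∈ Finset.Ioc 0 N, Λ n • c n) * L = ∑ n ∈ Finset.Ioc 0 N, Real.log n • c n +
      ∑ d ∈ Finset.Ioc 0 N, Λ d • c d * (L - ∑ m ∈ Finset.Ioc 0 (N / d), c m) := by
    rw [sum_Ioc_log_smul_eq hmul, ← Finset.sum_add_distrib, Finset.sum_mul]
    exact Finset.sum_congr rfl fun d _ => by ring
  rw [le_div_iff₀ (norm_pos_iff.2 hL0), ← norm_mul, hsplit]
  exact (norm_add_le _ _).trans
    (add_le_add hlog (norm_sum_vonMangoldt_smul_mul_sub_le hc hL N))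

end Twisted

variable {q : ℕ} {χ : DirichletCharacter ℂ q}

theorem norm_char_div_natCast_le (n : ℕ) : ‖χ (n : ZMod q) / (n : ℂ)‖ ≤ (n : ℝ)⁻¹ := by
  rw [norm_div, Complex.norm_natCast, div_eq_mul_inv]
  exact mul_le_of_le_one_left (by positivity) (χ.norm_le_one _)

theorem exists_norm_sum_log_smul_char_div_le [NeZero q] (hχ : χ ≠ 1) :
    ∃ C : ℝ, ∀ N : ℕ, ‖∑ n ∈ Finset.Ioc 0 N, Real.log n • (χ (n : ZMod q) / n)‖ ≤ C := by
  have hanti : AntitoneOn (fun n : ℕ => Real.log n / n) (Set.Ici 3) := by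
    have hexp {i : ℕ} (hi : 3 ≤ i) : Real.exp 1 ≤ i :=
      Real.exp_one_lt_three.le.trans (by exact_mod_cast hi)
    exact fun i hi j hj hij =>
      Real.log_div_self_antitoneOn (hexp hi) (hexp hj) (by exact_mod_cast hij)
  have hzero : Tendsto (fun n : ℕ => Real.log n / n) atTop (𝓝 0) :=
    Real.isLittleO_log_id_atTop.tendsto_div_nhds_zero.comp tendsto_natCast_atTop_atTop
  obtain ⟨l, hl⟩ := exists_tendsto_sum_range_smul_of_antitoneOn hanti hzero
    (norm_sum_range_char_le hχ)
  obtain ⟨C, hC⟩ := hl.norm.bddAbove_range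
  refine ⟨C, fun N => ?_⟩
  rw [sum_Ioc_zero_eq_sum_range (by simp)]
  simpa [div_mul_eq_mul_div, mul_div_assoc] using hC (Set.mem_range_self (N + 1))

theorem exists_norm_sum_vonMangoldt_smul_char_div_le [NeZero q] (hχ : χ ≠ 1) :
    ∃ C : ℝ, ∀ N : ℕ, ‖∑ n ∈ Finset.Ioc 0 N, Λ n • (χ (n : ZMod q) / n)‖ ≤ C := by
  obtain ⟨C, hC⟩ := exists_norm_sum_log_smul_char_div_le hχ
  have hmul (m n : ℕ) : χ ((m * n : ℕ) : ZMod q) / ((m * n : ℕ) : ℂ) =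
      χ (m : ZMod q) / m * (χ (n : ZMod q) / n) := by
    push_cast
    rw [map_mul, mul_div_mul_comm]
  refine ⟨_, fun N => norm_sum_vonMangoldt_smul_le (A := 2 * q) hmul norm_char_div_natCast_le
    (DirichletCharacter.LFunction_apply_one_ne_zero hχ) (fun M => ?_) (hC N)⟩
  rw [sum_Ioc_zero_eq_sum_range (by simp)]
  exact norm_LFunction_one_sub_sum_le hχ M

end MertensFirst

/-! ### Mertens' second theorem, plain and twisted -/

section MertensSecond

open scoped ArithmeticFunction.vonMangoldt

theorem summable_vonMangoldt_non_primes_div :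
    Summable fun n : ℕ => (if n.Prime then 0 else Λ n) / n := by
  have h := ArithmeticFunction.vonMangoldt.summable_residueClass_non_primes_div (0 : ZMod 1)
  refine h.congr fun n => ?_
  simp [ArithmeticFunction.vonMangoldt.residueClass, Set.indicator,
    Subsingleton.elim _ (0 : ZMod 1)]

theorem sum_Ioc_ite_prime {M : Type*} [AddCommMonoid M] (f : ℕ → M) (N : ℕ) :
    ∑ n ∈ Finset.Ioc 0 N, (if n.Prime then f n else 0) = ∑ p ∈ N.primesLE, f p := by
  rw [Nat.primesLE_eq_filter_Ioc_zero, Finset.sum_filter]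

theorem norm_sum_vonMangoldt_smul_sub_sum_primes_le {E : Type*} [NormedAddCommGroup E]
    [NormedSpace ℝ E] {c : ℕ → E} (hc : ∀ n, ‖c n‖ ≤ (n : ℝ)⁻¹) (N : ℕ) :
    ‖∑ n ∈ Finset.Ioc 0 N, Λ n • c n - ∑ p ∈ N.primesLE, Real.log p • c p‖
      ≤ ∑' n : ℕ, (if n.Prime then 0 else Λ n) / n := by
  have hterm (n : ℕ) : ‖Λ n • c n - if n.Prime then Real.log n • c n else 0‖
      ≤ (if n.Prime then 0 else Λ n) / n := by
    split_ifs with hn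
    · simp [ArithmeticFunction.vonMangoldt_apply_prime hn]
    · rw [sub_zero, norm_smul, Real.norm_of_nonneg ArithmeticFunction.vonMangoldt_nonneg,
        div_eq_mul_inv]
      exact mul_le_mul_of_nonneg_left (hc n) ArithmeticFunction.vonMangoldt_nonneg
  rw [← sum_Ioc_ite_prime, ← Finset.sum_sub_distrib]
  exact (norm_sum_le_of_le _ fun n _ => hterm n).trans
    (summable_vonMangoldt_non_primes_div.sum_le_tsum _ fun n _ => (norm_nonneg _).trans (hterm n))

theorem exists_tendsto_sum_Ioc_inv_log_smul {E : Type*} [NormedAddCommGroup E] [NormedSpace ℝ E]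
    [CompleteSpace E] {z : ℕ → E} {b : ℝ} (hz0 : z 0 = 0)
    (hz : ∀ N : ℕ, ‖∑ n ∈ Finset.Ioc 0 N, z n‖ ≤ b) :
    ∃ l, Tendsto (fun N : ℕ => ∑ n ∈ Finset.Ioc 0 N, (Real.log n)⁻¹ • z n) atTop (𝓝 l) := by
  have hanti : AntitoneOn (fun n : ℕ => (Real.log n)⁻¹) (Set.Ici 2) := fun i hi j _ hij => by
    have hi' : (1 : ℝ) < i := by exact_mod_cast hi
    have : 0 < Real.log i := Real.log_pos hi'
    dsimp only
    gcongr
  have hzero : Tendsto (fun n : ℕ => (Real.log n)⁻¹) atTop (𝓝 0) :=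
    (Real.tendsto_log_atTop.comp tendsto_natCast_atTop_atTop).inv_tendsto_atTop
  have hbound (N : ℕ) : ‖∑ n ∈ Finset.range N, z n‖ ≤ b := by
    cases N with
    | zero => simpa using hz 0
    | succ N => simpa only [sum_Ioc_zero_eq_sum_range hz0] using hz N
  obtain ⟨l, hl⟩ := exists_tendsto_sum_range_smul_of_antitoneOn hanti hzero hbound
  refine ⟨l, ((tendsto_add_atTop_iff_nat 1).2 hl).congr fun N => ?_⟩
  rw [sum_Ioc_zero_eq_sum_range (by simp)]

theorem inv_log_smul_log_smul {E : Type*} [AddCommGroup E] [Module ℝ E] {p : ℕ} (hp : p.Prime)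
    (x : E) : (Real.log p)⁻¹ • Real.log p • x = x :=
  inv_smul_smul₀ (Real.log_pos (by exact_mod_cast hp.one_lt)).ne' x

theorem exists_tendsto_sum_primes_char_div {q : ℕ} [NeZero q] {χ : DirichletCharacter ℂ q}
    (hχ : χ ≠ 1) :
    ∃ l, Tendsto (fun N : ℕ => ∑ p ∈ N.primesLE, χ (p : ZMod q) / p) atTop (𝓝 l) := by
  obtain ⟨C, hC⟩ := exists_norm_sum_vonMangoldt_smul_char_div_le hχ
  have hbound (N : ℕ) :=
    (norm_le_norm_add_norm_sub _ _).trans (add_le_add (hC N)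
      (norm_sum_vonMangoldt_smul_sub_sum_primes_le (norm_char_div_natCast_le (χ := χ)) N))
  simp only [← sum_Ioc_ite_prime] at hbound
  obtain ⟨l, hl⟩ := exists_tendsto_sum_Ioc_inv_log_smul (by simp) hbound
  refine ⟨l, hl.congr fun N => ?_⟩
  rw [← sum_Ioc_ite_prime]
  refine Finset.sum_congr rfl fun p _ => ?_
  split_ifs with hp
  · exact inv_log_smul_log_smul hp _
  · exact smul_zero _

theorem log_log_add_one_sub_le {n : ℕ} (hn : 2 ≤ n) :
    Real.log (Real.log (n + 1)) - Real.log (Real.log n) ≤ (Real.log n)⁻¹ * (n : ℝ)⁻¹ := by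
  have h2 : (2 : ℝ) ≤ n := by exact_mod_cast hn
  have hlog : 0 < Real.log n := Real.log_pos (by linarith)
  have hlog' : 0 < Real.log (n + 1) := Real.log_pos (by linarith)
  have hinner : Real.log (n + 1) - Real.log n ≤ (n : ℝ)⁻¹ := by
    rw [← Real.log_div (by positivity) (by positivity)]
    convert! Real.log_le_sub_one_of_pos (x := ((n : ℝ) + 1) / n) (by positivity) using 1
    field_simp
    ring
  calc _ = Real.log (Real.log (n + 1) / Real.log n) := (Real.log_div hlog'.ne' hlog.ne').symm
    _ ≤ Real.log (n + 1) / Real.log n - 1 := Real.log_le_sub_one_of_pos (by positivity)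
    _ = (Real.log n)⁻¹ * (Real.log (n + 1) - Real.log n) := by field_simp
    _ ≤ _ := by gcongr

theorem le_log_log_add_one_sub {n : ℕ} (hn : 2 ≤ n) :
    (Real.log (n + 1))⁻¹ * ((n : ℝ) + 1)⁻¹
      ≤ Real.log (Real.log (n + 1)) - Real.log (Real.log n) := by
  have h2 : (2 : ℝ) ≤ n := by exact_mod_cast hn
  have hlog : 0 < Real.log n := Real.log_pos (by linarith)
  have hlog' : 0 < Real.log (n + 1) := Real.log_pos (by linarith)
  have hinner : ((n : ℝ) + 1)⁻¹ ≤ Real.log (n + 1) - Real.log n := by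
    rw [← Real.log_div (by positivity) (by positivity)]
    convert! Real.one_sub_inv_le_log_of_pos (x := ((n : ℝ) + 1) / n) (by positivity) using 1
    field_simp
    ring
  calc _ ≤ (Real.log (n + 1))⁻¹ * (Real.log (n + 1) - Real.log n) := by gcongr
    _ = 1 - (Real.log (n + 1) / Real.log n)⁻¹ := by field_simp
    _ ≤ Real.log (Real.log (n + 1) / Real.log n) :=
        Real.one_sub_inv_le_log_of_pos (by positivity)
    _ = _ := Real.log_div hlog'.ne' hlog.ne'

theorem exists_tendsto_sum_range_sub {f g : ℕ → ℝ} {k : ℕ} (hf : ∀ n ≥ k, 0 ≤ f n)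
    (hlower : ∀ n ≥ k, f (n + 1) ≤ g (n + 1) - g n) (hupper : ∀ n ≥ k, g (n + 1) - g n ≤ f n) :
    ∃ l, Tendsto (fun n => ∑ i ∈ Finset.range (n + 1), f i - g n) atTop (𝓝 l) := by
  set u : ℕ → ℝ := fun n => ∑ i ∈ Finset.range n, f i - g n with hu
  set v : ℕ → ℝ := fun n => ∑ i ∈ Finset.range (n + 1), f i - g n with hv
  have hvu (n : ℕ) : v n = u n + f n := by
    simp only [hu, hv, Finset.sum_range_succ]
    ring
  have hu_mono : Monotone fun n => u (n + k) := monotone_nat_of_le_succ fun n => by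
    simp only [hu, Nat.add_right_comm n 1 k, Finset.sum_range_succ _ (n + k)]
    linarith [hupper (n + k) (Nat.le_add_left k n)]
  have hv_anti : Antitone fun n => v (n + k) := antitone_nat_of_succ_le fun n => by
    simp only [hv, Nat.add_right_comm n 1 k, Finset.sum_range_succ _ (n + k + 1)]
    linarith [hlower (n + k) (Nat.le_add_left k n)]
  have hbdd : BddBelow (Set.range fun n => v (n + k)) := by
    refine ⟨u (0 + k), ?_⟩
    rintro _ ⟨n, rfl⟩
    linarith [hu_mono (Nat.zero_le n), hvu (n + k), hf (n + k) (Nat.le_add_left k n)]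
  exact ⟨_, (tendsto_add_atTop_iff_nat k).1 (tendsto_atTop_ciInf hv_anti hbdd)⟩

theorem exists_tendsto_sum_inv_log_mul_inv_sub_log_log :
    ∃ l : ℝ, Tendsto (fun N : ℕ => ∑ n ∈ Finset.Ioc 0 N, (Real.log n)⁻¹ * (n : ℝ)⁻¹ -
      Real.log (Real.log N)) atTop (𝓝 l) := by
  obtain ⟨l, hl⟩ := exists_tendsto_sum_range_sub (k := 2)
    (f := fun n => (Real.log n)⁻¹ * (n : ℝ)⁻¹) (g := fun n => Real.log (Real.log n))
    (fun n _ => by positivity)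
    (fun n hn => by simpa using le_log_log_add_one_sub hn)
    (fun n hn => by simpa using log_log_add_one_sub_le hn)
  exact ⟨l, hl.congr fun N => by rw [sum_Ioc_zero_eq_sum_range (by simp)]⟩

theorem abs_harmonic_sub_log_le (N : ℕ) : |(harmonic N : ℝ) - Real.log N| ≤ 1 := by
  have hlog : Real.log N ≤ Real.log (N + 1 : ℕ) := by
    rcases N.eq_zero_or_pos with rfl | hN
    · simp
    · exact Real.log_le_log (by exact_mod_cast hN) (by exact_mod_cast N.le_succ)
  rw [abs_le]
  constructor <;> linarith [log_add_one_le_harmonic N, harmonic_le_one_add_log N]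

theorem exists_abs_sum_primes_log_div_sub_harmonic_le :
    ∃ b : ℝ, ∀ N : ℕ, |∑ p ∈ N.primesLE, Real.log p / p - harmonic N| ≤ b := by
  refine ⟨(∑' n : ℕ, (if n.Prime then 0 else Λ n) / n) + (Real.log 4 + 4) + 1, fun N => ?_⟩
  have hprimes := norm_sum_vonMangoldt_smul_sub_sum_primes_le (c := fun n : ℕ => (n : ℝ)⁻¹)
    (fun n => by simp) N
  simp only [smul_eq_mul, ← div_eq_mul_inv, Real.norm_eq_abs] at hprimes
  have hmertens := abs_sum_vonMangoldt_div_sub_log_le N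
  have hharmonic := abs_harmonic_sub_log_le N
  rw [abs_le] at *
  constructor <;> linarith

theorem exists_tendsto_sum_primes_inv_sub_log_log :
    ∃ M : ℝ, Tendsto (fun N : ℕ => ∑ p ∈ N.primesLE, (p : ℝ)⁻¹ - Real.log (Real.log N))
      atTop (𝓝 M) := by
  obtain ⟨b, hb⟩ := exists_abs_sum_primes_log_div_sub_harmonic_le
  have hharmonic (N : ℕ) : ∑ n ∈ Finset.Ioc 0 N, (n : ℝ)⁻¹ = harmonic N := by
    rw [harmonic_eq_sum_Icc]
    push_cast
    rfl
  obtain ⟨l, hl⟩ := exists_tendsto_sum_Ioc_inv_log_smul (b := b)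
    (z := fun n : ℕ => (if n.Prime then Real.log n / n else 0) - (n : ℝ)⁻¹) (by simp) fun N => by
      rw [Finset.sum_sub_distrib, sum_Ioc_ite_prime fun n : ℕ => Real.log n / n, hharmonic]
      exact hb N
  obtain ⟨l', hl'⟩ := exists_tendsto_sum_inv_log_mul_inv_sub_log_log
  refine ⟨l + l', (hl.add hl').congr fun N => ?_⟩
  rw [← add_sub_assoc, ← Finset.sum_add_distrib, ← sum_Ioc_ite_prime]
  congr 1
  refine Finset.sum_congr rfl fun n _ => ?_
  rw [smul_eq_mul, ← mul_add, sub_add_cancel]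
  split_ifs with hn
  · exact inv_log_smul_log_smul hn (n : ℝ)⁻¹
  · exact mul_zero _

end MertensSecond

/-! ### An Abelian theorem for Laplace transforms -/

section LaplaceAbelian

open MeasureTheory

variable {ι E : Type*} [NormedAddCommGroup E]

/-- The distribution function of a family of point masses: the total of the weights `b i` over the
points `t i` of `(-∞, τ]`, with the default value `0` if they are not summable. -/
noncomputable def cumulativeWeight (b : ι → E) (t : ι → ℝ) (τ : ℝ) : E :=
  ∑' i, (Set.Ici (t i)).indicator (fun _ => b i) τ

variable {b : ι → E} {t : ι → ℝ}

theorem integral_Ioi_exp_neg_mul_indicator_Ici {δ a : ℝ} (hδ : 0 < δ) (ha : 0 ≤ a) :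
    ∫ τ in Set.Ioi 0, (Set.Ici a).indicator (fun τ => Real.exp (-δ * τ)) τ
      = δ⁻¹ * Real.exp (-δ * a) := by
  rw [← integral_Ici_eq_integral_Ioi, setIntegral_indicator measurableSet_Ici, Set.Ici_inter_Ici,
    sup_of_le_right ha, integral_Ici_eq_integral_Ioi, integral_exp_mul_Ioi (neg_lt_zero.2 hδ)]
  field_simp

theorem norm_indicator_Ici_le_exp_mul (i : ι) (τ : ℝ) :
    ‖(Set.Ici (t i)).indicator (fun _ => b i) τ‖ ≤ Real.exp τ * (‖b i‖ * Real.exp (-t i)) := by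
  by_cases h : t i ≤ τ
  · rw [Set.indicator_of_mem (Set.mem_Ici.2 h), mul_left_comm, ← Real.exp_add]
    exact le_mul_of_one_le_right (norm_nonneg _) (Real.one_le_exp (by linarith))
  · rw [Set.indicator_of_notMem (by simpa using h), norm_zero]
    positivity

theorem norm_cumulativeWeight_le (hs : Summable fun i => ‖b i‖ * Real.exp (-t i)) (τ : ℝ) :
    ‖cumulativeWeight b t τ‖ ≤ Real.exp τ * ∑' i, ‖b i‖ * Real.exp (-t i) :=
  tsum_of_norm_bounded (hs.hasSum.mul_left _) (norm_indicator_Ici_le_exp_mul · τ)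

variable [CompleteSpace E]

theorem hasSum_cumulativeWeight (hs : Summable fun i => ‖b i‖ * Real.exp (-t i)) (τ : ℝ) :
    HasSum (fun i => (Set.Ici (t i)).indicator (fun _ => b i) τ) (cumulativeWeight b t τ) :=
  (Summable.of_norm_bounded (hs.mul_left _) (norm_indicator_Ici_le_exp_mul · τ)).hasSum

theorem stronglyMeasurable_cumulativeWeight [Countable ι]
    (hs : Summable fun i => ‖b i‖ * Real.exp (-t i)) :
    StronglyMeasurable (cumulativeWeight b t) := by
  refine stronglyMeasurable_of_tendsto (f := fun (s : Finset ι) (τ : ℝ) =>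
    ∑ i ∈ s, (Set.Ici (t i)).indicator (fun _ => b i) τ) atTop (fun s => ?_)
    (tendsto_pi_nhds.2 fun τ => hasSum_cumulativeWeight hs τ)
  exact Finset.stronglyMeasurable_fun_sum _ fun i _ =>
    stronglyMeasurable_const.indicator measurableSet_Ici

variable [NormedSpace ℝ E]

theorem hasSum_exp_neg_mul_smul [Countable ι] (ht : ∀ i, 0 ≤ t i) {δ : ℝ} (hδ : 0 < δ)
    (hs : Summable fun i => ‖b i‖ * Real.exp (-δ * t i)) :
    HasSum (fun i => Real.exp (-δ * t i) • b i)
      (δ • ∫ τ in Set.Ioi 0, Real.exp (-δ * τ) • cumulativeWeight b t τ) := by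
  have hexp (i : ι) : IntegrableOn ((Set.Ici (t i)).indicator fun τ => Real.exp (-δ * τ))
      (Set.Ioi 0) :=
    (integrableOn_exp_mul_Ioi (neg_lt_zero.2 hδ) 0).indicator measurableSet_Ici
  have hnorm (i : ι) :
      ∫ τ in Set.Ioi 0, ‖(Set.Ici (t i)).indicator (fun τ => Real.exp (-δ * τ)) τ • b i‖
        = δ⁻¹ * (‖b i‖ * Real.exp (-δ * t i)) := by
    simp_rw [norm_smul, norm_indicator_eq_indicator_norm, Real.norm_of_nonneg (Real.exp_nonneg _)]
    rw [integral_mul_const, integral_Ioi_exp_neg_mul_indicator_Ici hδ (ht i), mul_assoc,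
      mul_comm ‖b i‖]
  have h := (hasSum_integral_of_summable_integral_norm (fun i => (hexp i).smul_const (b i))
    (by simpa only [hnorm] using hs.mul_left δ⁻¹)).const_smul δ
  simp only [integral_smul_const, integral_Ioi_exp_neg_mul_indicator_Ici hδ (ht _), smul_smul,
    mul_inv_cancel_left₀ hδ.ne'] at h
  convert! h using 4 with τ
  rw [cumulativeWeight, ← tsum_const_smul'']
  refine tsum_congr fun i => ?_
  by_cases hi : t i ≤ τ <;> simp [Set.indicator, hi]

theorem tendsto_smul_integral_exp_neg_mul_smul {D : ℝ → E} {C : ℝ} {l : E}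
    (hmeas : StronglyMeasurable D) (hC : ∀ τ > 0, ‖D τ‖ ≤ C) (hD : Tendsto D atTop (𝓝 l)) :
    Tendsto (fun δ : ℝ => δ • ∫ τ in Set.Ioi 0, Real.exp (-δ * τ) • D τ) (𝓝[>] 0) (𝓝 l) := by
  have hlim : Tendsto (fun δ : ℝ => ∫ u in Set.Ioi (0 : ℝ), Real.exp (-u) • D (u / δ)) (𝓝[>] 0)
      (𝓝 (∫ u in Set.Ioi (0 : ℝ), Real.exp (-u) • l)) := by
    refine tendsto_integral_filter_of_dominated_convergence (fun u => Real.exp (-u) * C)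
      (.of_forall fun δ => ?_) ?_ ?_ ?_
    · exact ((Real.continuous_exp.comp continuous_neg).stronglyMeasurable.smul
        (hmeas.comp_measurable (measurable_id.div_const δ))).aestronglyMeasurable
    · filter_upwards [self_mem_nhdsWithin] with δ hδ
      filter_upwards [ae_restrict_mem measurableSet_Ioi] with u hu
      rw [norm_smul, Real.norm_of_nonneg (Real.exp_nonneg _)]
      exact mul_le_mul_of_nonneg_left (hC _ (div_pos hu hδ)) (Real.exp_nonneg _)
    · simpa using (exp_neg_integrableOn_Ioi 0 one_pos).mul_const C
    · filter_upwards [ae_restrict_mem measurableSet_Ioi] with u hu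
      exact tendsto_const_nhds.smul (hD.comp (tendsto_inv_nhdsGT_zero.const_mul_atTop hu))
  rw [integral_smul_const, integral_exp_neg_Ioi_zero, one_smul] at hlim
  refine hlim.congr' ?_
  filter_upwards [self_mem_nhdsWithin] with δ (hδ : 0 < δ)
  have hsubst := integral_comp_mul_left_Ioi (fun u => Real.exp (-u) • D (u / δ)) 0 hδ
  rw [mul_zero] at hsubst
  simp only [mul_div_cancel_left₀ _ hδ.ne', ← neg_mul] at hsubst
  rw [hsubst, smul_inv_smul₀ hδ.ne']

theorem tendsto_tsum_exp_neg_mul_smul [Countable ι] (ht : ∀ i, 0 ≤ t i)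
    (hs : ∀ δ > 0, Summable fun i => ‖b i‖ * Real.exp (-δ * t i)) {l : E}
    (hl : Tendsto (cumulativeWeight b t) atTop (𝓝 l)) :
    Tendsto (fun δ : ℝ => ∑' i, Real.exp (-δ * t i) • b i) (𝓝[>] 0) (𝓝 l) := by
  have hs1 : Summable fun i => ‖b i‖ * Real.exp (-t i) := by simpa using hs 1 one_pos
  obtain ⟨T, hT⟩ := eventually_atTop.1 (hl.norm.eventually_le_const (lt_add_one ‖l‖))
  have hbound (τ : ℝ) : ‖cumulativeWeight b t τ‖
      ≤ max (‖l‖ + 1) (Real.exp T * ∑' i, ‖b i‖ * Real.exp (-t i)) := by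
    rcases le_total T τ with h | h
    · exact (hT τ h).trans (le_max_left _ _)
    · refine (norm_cumulativeWeight_le hs1 τ).trans (le_max_of_le_right ?_)
      have : 0 ≤ ∑' i, ‖b i‖ * Real.exp (-t i) := tsum_nonneg fun i => by positivity
      gcongr
  refine (tendsto_smul_integral_exp_neg_mul_smul (stronglyMeasurable_cumulativeWeight hs1)
    (fun τ _ => hbound τ) hl).congr' ?_
  filter_upwards [self_mem_nhdsWithin] with δ hδ
  exact (hasSum_exp_neg_mul_smul ht hδ (hs δ hδ)).tsum_eq.symm

end LaplaceAbelian

/-! ### Mertens' third theorem -/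

section MertensThird

theorem tendsto_log_sub_log_of_tendsto_div {α : Type*} {l : Filter α} {f g : α → ℝ}
    (h : Tendsto (fun x => f x / g x) l (𝓝 1)) :
    Tendsto (fun x => Real.log (f x) - Real.log (g x)) l (𝓝 0) := by
  have hlog := h.log one_ne_zero
  rw [Real.log_one] at hlog
  refine hlog.congr' ?_
  filter_upwards [h.eventually_ne one_ne_zero] with x hx
  exact Real.log_div (div_ne_zero_iff.1 hx).1 (div_ne_zero_iff.1 hx).2

theorem tendsto_log_natFloor_sub_log :
    Tendsto (fun x : ℝ => Real.log ⌊x⌋₊ - Real.log x) atTop (𝓝 0) :=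
  tendsto_log_sub_log_of_tendsto_div tendsto_nat_floor_div_atTop

theorem tendsto_log_log_natFloor_sub_log_log :
    Tendsto (fun x : ℝ => Real.log (Real.log ⌊x⌋₊) - Real.log (Real.log x)) atTop (𝓝 0) := by
  refine tendsto_log_sub_log_of_tendsto_div ?_
  have h := (tendsto_log_natFloor_sub_log.div_atTop Real.tendsto_log_atTop).add_const 1
  rw [zero_add] at h
  refine h.congr' ?_
  filter_upwards [eventually_gt_atTop 1] with x hx
  rw [sub_div, div_self (Real.log_pos hx).ne', sub_add_cancel]

theorem tendsto_harmonic_natFloor_sub_log :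
    Tendsto (fun x : ℝ => (harmonic ⌊x⌋₊ : ℝ) - Real.log x) atTop
      (𝓝 Real.eulerMascheroniConstant) := by
  have h := (Real.tendsto_harmonic_sub_log.comp (tendsto_nat_floor_atTop (α := ℝ))).add
    tendsto_log_natFloor_sub_log
  rw [add_zero] at h
  exact h.congr fun x => sub_add_sub_cancel _ _ _

theorem hasSum_indicator_Ici_log_primes_inv (τ : ℝ) :
    HasSum (fun p : Nat.Primes => (Set.Ici (Real.log p)).indicator (fun _ => (p : ℝ)⁻¹) τ)
      (∑ p ∈ ⌊Real.exp τ⌋₊.primesLE, (p : ℝ)⁻¹) := by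
  rw [Nat.Primes.hasSum_iff_hasSum_ite
    (fun n : ℕ => (Set.Ici (Real.log n)).indicator (fun _ => (n : ℝ)⁻¹) τ)]
  have hmem {p : ℕ} (hp : p.Prime) : p ∈ ⌊Real.exp τ⌋₊.primesLE ↔ Real.log p ≤ τ := by
    rw [Nat.mem_primesLE, Nat.le_floor_iff (Real.exp_nonneg τ),
      Real.log_le_iff_le_exp (by exact_mod_cast hp.pos), and_iff_left hp]
  have hsupport (n : ℕ) (hn : n ∉ ⌊Real.exp τ⌋₊.primesLE) :
      (if n.Prime then (Set.Ici (Real.log n)).indicator (fun _ => (n : ℝ)⁻¹) τ else 0) = 0 := by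
    split_ifs with hp
    · exact Set.indicator_of_notMem (fun h => hn ((hmem hp).2 h)) _
    · rfl
  convert! hasSum_sum_of_ne_finset_zero (L := .unconditional ℕ) hsupport using 1
  refine Finset.sum_congr rfl fun p hp => ?_
  have hprime := Nat.prime_of_mem_primesLE hp
  rw [if_pos hprime, Set.indicator_of_mem (Set.mem_Ici.2 ((hmem hprime).1 hp))]

theorem hasSum_indicator_Ici_add_one_inv (τ : ℝ) :
    HasSum (fun n : ℕ => (Set.Ici ((n : ℝ) + 1)).indicator (fun _ => ((n : ℝ) + 1)⁻¹) τ)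
      (harmonic ⌊τ⌋₊) := by
  have hmem {n : ℕ} : n ∈ Finset.range ⌊τ⌋₊ ↔ (n : ℝ) + 1 ≤ τ := by
    rw [Finset.mem_range, ← Nat.succ_le_iff, Nat.le_floor_iff' n.succ_ne_zero]
    push_cast
    rfl
  have hsupport (n : ℕ) (hn : n ∉ Finset.range ⌊τ⌋₊) :
      (Set.Ici ((n : ℝ) + 1)).indicator (fun _ => ((n : ℝ) + 1)⁻¹) τ = 0 :=
    Set.indicator_of_notMem (fun h => hn (hmem.2 h)) _
  convert! hasSum_sum_of_ne_finset_zero (L := .unconditional ℕ) hsupport using 1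
  rw [harmonic]
  push_cast
  refine Finset.sum_congr rfl fun n hn => ?_
  rw [Set.indicator_of_mem (Set.mem_Ici.2 (hmem.1 hn))]

theorem tendsto_sum_primes_inv_sub_harmonic {M : ℝ}
    (hM : Tendsto (fun N : ℕ => ∑ p ∈ N.primesLE, (p : ℝ)⁻¹ - Real.log (Real.log N)) atTop
      (𝓝 M)) :
    Tendsto (fun τ : ℝ => ∑ p ∈ ⌊Real.exp τ⌋₊.primesLE, (p : ℝ)⁻¹ - harmonic ⌊τ⌋₊) atTop
      (𝓝 (M - Real.eulerMascheroniConstant)) := by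
  have hprimes := hM.comp (tendsto_nat_floor_atTop.comp Real.tendsto_exp_atTop)
  have hfloor := tendsto_log_log_natFloor_sub_log_log.comp Real.tendsto_exp_atTop
  have h := (hprimes.add hfloor).sub tendsto_harmonic_natFloor_sub_log
  rw [add_zero] at h
  refine h.congr fun τ => ?_
  simp only [Function.comp_apply, Real.log_exp]
  ring

theorem inv_mul_exp_neg_mul_log {x : ℝ} (hx : 0 < x) (δ : ℝ) :
    x⁻¹ * Real.exp (-δ * Real.log x) = x ^ (-(1 + δ)) := by
  rw [mul_comm (-δ), ← Real.rpow_def_of_pos hx, ← Real.rpow_neg_one, ← Real.rpow_add hx, neg_add]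

theorem hasSum_inv_mul_exp_neg_mul {δ : ℝ} (hδ : 0 < δ) :
    HasSum (fun n : ℕ => ((n : ℝ) + 1)⁻¹ * Real.exp (-δ * (n + 1)))
      (-Real.log (1 - Real.exp (-δ))) := by
  have h := Real.hasSum_pow_div_log_of_abs_lt_one (x := Real.exp (-δ))
    (by rw [abs_of_pos (Real.exp_pos _), Real.exp_lt_one_iff]; linarith)
  refine h.congr_fun fun n => ?_
  rw [← Real.exp_nat_mul]
  push_cast
  ring_nf

theorem tendsto_tsum_primes_rpow_add_log {M : ℝ}
    (hM : Tendsto (fun N : ℕ => ∑ p ∈ N.primesLE, (p : ℝ)⁻¹ - Real.log (Real.log N)) atTop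
      (𝓝 M)) :
    Tendsto (fun δ : ℝ => ∑' p : Nat.Primes, (p : ℝ) ^ (-(1 + δ)) + Real.log (1 - Real.exp (-δ)))
      (𝓝[>] 0) (𝓝 (M - Real.eulerMascheroniConstant)) := by
  -- The point masses `1/p` at `log p` are compared with the point masses `1/n` at `n`.
  let b : Nat.Primes ⊕ ℕ → ℝ := Sum.elim (fun p => (p : ℝ)⁻¹) fun n => -((n : ℝ) + 1)⁻¹
  let t : Nat.Primes ⊕ ℕ → ℝ := Sum.elim (fun p => Real.log p) fun n => (n : ℝ) + 1
  have hweight (τ : ℝ) : cumulativeWeight b t τ =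
      ∑ p ∈ ⌊Real.exp τ⌋₊.primesLE, (p : ℝ)⁻¹ - harmonic ⌊τ⌋₊ := by
    rw [sub_eq_add_neg]
    refine (HasSum.sum (hasSum_indicator_Ici_log_primes_inv τ) ?_).tsum_eq
    convert! (hasSum_indicator_Ici_add_one_inv τ).neg using 2 with n
    exact congrFun (Set.indicator_neg (Set.Ici ((n : ℝ) + 1)) fun _ => ((n : ℝ) + 1)⁻¹) τ
  have hlimit : Tendsto (cumulativeWeight b t) atTop (𝓝 (M - Real.eulerMascheroniConstant)) :=
    (tendsto_sum_primes_inv_sub_harmonic hM).congr fun τ => (hweight τ).symm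
  have hpos (p : Nat.Primes) : (0 : ℝ) < p := by exact_mod_cast p.2.pos
  have hprimes {δ : ℝ} (hδ : 0 < δ) : Summable fun p : Nat.Primes => (p : ℝ) ^ (-(1 + δ)) :=
    Nat.Primes.summable_rpow.2 (by linarith)
  have hsum {δ : ℝ} (hδ : 0 < δ) : HasSum (fun i => Real.exp (-δ * t i) • b i)
      (∑' p : Nat.Primes, (p : ℝ) ^ (-(1 + δ)) + Real.log (1 - Real.exp (-δ))) := by
    refine HasSum.sum ?_ ?_
    · convert! (hprimes hδ).hasSum using 2 with p
      rw [← inv_mul_exp_neg_mul_log (hpos p) δ, mul_comm]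
      rfl
    · rw [← neg_neg (Real.log _)]
      convert! (hasSum_inv_mul_exp_neg_mul hδ).neg using 2 with n
      simp [b, t, mul_comm]
  refine (tendsto_tsum_exp_neg_mul_smul (fun i => ?_) (fun δ hδ => ?_) hlimit).congr' ?_
  · rcases i with p | n
    · exact Real.log_natCast_nonneg _
    · exact n.cast_add_one_pos.le
  · simpa [abs_mul, mul_comm] using (hsum hδ).summable.abs
  · filter_upwards [self_mem_nhdsWithin] with δ hδ using (hsum hδ).tsum_eq

theorem norm_neg_log_one_sub_sub_le {w : ℂ} (hw : ‖w‖ ≤ 1 / 2) :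
    ‖-Complex.log (1 - w) - w‖ ≤ ‖w‖ ^ 2 := by
  have h := Complex.norm_log_one_add_sub_self_le (z := -w) (by rw [norm_neg]; linarith)
  rw [norm_neg, ← sub_eq_add_neg, sub_neg_eq_add] at h
  have hinv : (1 - ‖w‖)⁻¹ ≤ 2 := by
    rw [inv_le_comm₀ (by linarith) two_pos]
    linarith
  calc ‖-Complex.log (1 - w) - w‖ = ‖Complex.log (1 - w) + w‖ := by
        rw [← norm_neg, neg_sub, sub_neg_eq_add, add_comm]
    _ ≤ ‖w‖ ^ 2 * (1 - ‖w‖)⁻¹ / 2 := h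
    _ ≤ ‖w‖ ^ 2 * 2 / 2 := by gcongr
    _ = ‖w‖ ^ 2 := mul_div_cancel_right₀ _ two_ne_zero

theorem abs_neg_log_one_sub_sub_le {x : ℝ} (hx : |x| ≤ 1 / 2) :
    |-Real.log (1 - x) - x| ≤ x ^ 2 := by
  have h := norm_neg_log_one_sub_sub_le (w := x) (by simpa using hx)
  rw [← Complex.ofReal_one, ← Complex.ofReal_sub,
    ← Complex.ofReal_log (by linarith [(abs_le.1 hx).2])] at h
  simpa only [← Complex.ofReal_neg, ← Complex.ofReal_sub, Complex.norm_real, Real.norm_eq_abs,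
    sq_abs] using h

theorem prime_inv_le_half {p : ℕ} (hp : p.Prime) : (p : ℝ)⁻¹ ≤ 1 / 2 := by
  rw [one_div]
  exact inv_anti₀ two_pos (by exact_mod_cast hp.two_le)

theorem prime_rpow_neg_le_inv {p : ℕ} (hp : p.Prime) {s : ℝ} (hs : 1 ≤ s) :
    (p : ℝ) ^ (-s) ≤ (p : ℝ)⁻¹ := by
  rw [← Real.rpow_neg_one]
  exact Real.rpow_le_rpow_of_exponent_le (by exact_mod_cast hp.one_le) (by linarith)

theorem prime_rpow_neg_le_half {p : ℕ} (hp : p.Prime) {s : ℝ} (hs : 1 ≤ s) :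
    (p : ℝ) ^ (-s) ≤ 1 / 2 :=
  (prime_rpow_neg_le_inv hp hs).trans (prime_inv_le_half hp)

theorem abs_neg_log_one_sub_prime_rpow_sub_le {p : ℕ} (hp : p.Prime) {s : ℝ} (hs : 1 ≤ s) :
    |-Real.log (1 - (p : ℝ) ^ (-s)) - (p : ℝ) ^ (-s)| ≤ ((p : ℝ)⁻¹) ^ 2 := by
  have hnonneg : 0 ≤ (p : ℝ) ^ (-s) := by positivity
  refine (abs_neg_log_one_sub_sub_le ?_).trans
    (pow_le_pow_left₀ hnonneg (prime_rpow_neg_le_inv hp hs) 2)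
  exact (abs_of_nonneg hnonneg).trans_le (prime_rpow_neg_le_half hp hs)

theorem summable_natCast_inv_sq : Summable fun n : ℕ => ((n : ℝ)⁻¹) ^ 2 := by
  simpa only [inv_pow] using Real.summable_nat_pow_inv.2 one_lt_two

theorem summable_primes_inv_sq : Summable fun p : Nat.Primes => ((p : ℝ)⁻¹) ^ 2 :=
  summable_natCast_inv_sq.comp_injective Nat.Primes.coe_nat_injective

/-- The contribution of the prime powers `p ^ j`, `j ≥ 2`, to `log ζ(s)`; the series is dominated
on `s ≥ 1`. -/
noncomputable def logZetaRemainder (s : ℝ) : ℝ :=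
  ∑' p : Nat.Primes, (-Real.log (1 - (p : ℝ) ^ (-s)) - (p : ℝ) ^ (-s))

theorem hasSum_logZetaRemainder {s : ℝ} (hs : 1 ≤ s) :
    HasSum (fun p : Nat.Primes => -Real.log (1 - (p : ℝ) ^ (-s)) - (p : ℝ) ^ (-s))
      (logZetaRemainder s) :=
  (Summable.of_norm_bounded summable_primes_inv_sq fun p =>
    abs_neg_log_one_sub_prime_rpow_sub_le p.2 hs).hasSum

theorem continuousOn_logZetaRemainder : ContinuousOn logZetaRemainder (Set.Ici 1) := by
  refine continuousOn_tsum (fun p => ?_) summable_primes_inv_sq fun p s hs =>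
    abs_neg_log_one_sub_prime_rpow_sub_le p.2 hs
  have hp : (p : ℝ) ≠ 0 := by exact_mod_cast p.2.ne_zero
  have hrpow : Continuous fun s : ℝ => (p : ℝ) ^ (-s) :=
    (Real.continuous_const_rpow hp).comp continuous_neg
  refine ContinuousOn.sub (ContinuousOn.neg ?_) hrpow.continuousOn
  refine (continuous_const.sub hrpow).continuousOn.log fun s hs => ?_
  change 1 - (p : ℝ) ^ (-s) ≠ 0
  linarith [prime_rpow_neg_le_half p.2 (Set.mem_Ici.1 hs)]

theorem log_riemannZeta_eq_tsum_primes_add {s : ℝ} (hs : 1 < s) :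
    Real.log (riemannZeta s).re = ∑' p : Nat.Primes, (p : ℝ) ^ (-s) + logZetaRemainder s := by
  have hterm (p : Nat.Primes) : -Complex.log (1 - (p : ℂ) ^ (-(s : ℂ))) =
      ((-Real.log (1 - (p : ℝ) ^ (-s)) : ℝ) : ℂ) := by
    have : (0 : ℝ) ≤ 1 - (p : ℝ) ^ (-s) := by linarith [prime_rpow_neg_le_half p.2 hs.le]
    rw [Complex.ofReal_neg, Complex.ofReal_log this, Complex.ofReal_sub,
      Complex.ofReal_cpow (Nat.cast_nonneg _)]
    simp
  rw [← riemannZeta_eulerProduct_exp_log (by simpa using hs), tsum_congr hterm,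
    ← Complex.ofReal_tsum, Complex.exp_ofReal_re, Real.log_exp, logZetaRemainder,
    ← (Nat.Primes.summable_rpow.2 (by linarith)).tsum_add (hasSum_logZetaRemainder hs.le).summable]
  simp only [add_sub_cancel]

theorem tendsto_log_one_sub_exp_neg_sub_log :
    Tendsto (fun δ : ℝ => Real.log (1 - Real.exp (-δ)) - Real.log δ) (𝓝[>] 0) (𝓝 0) := by
  have hderiv : HasDerivAt (fun δ : ℝ => 1 - Real.exp (-δ)) 1 0 := by
    simpa using ((hasDerivAt_neg (0 : ℝ)).exp).const_sub 1
  have h := hderiv.tendsto_slope_zero_right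
  simp only [zero_add, neg_zero, Real.exp_zero, sub_self, sub_zero, smul_eq_mul] at h
  exact tendsto_log_sub_log_of_tendsto_div (h.congr fun δ => inv_mul_eq_div _ _)

theorem tendsto_one_add_nhdsGT_zero : Tendsto (fun δ : ℝ => 1 + δ) (𝓝[>] 0) (𝓝[>] 1) :=
  (map_add_left_nhdsGT.trans (by rw [add_zero])).le

theorem sub_eulerMascheroniConstant_add_logZetaRemainder_one {M : ℝ}
    (hM : Tendsto (fun N : ℕ => ∑ p ∈ N.primesLE, (p : ℝ)⁻¹ - Real.log (Real.log N)) atTop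
      (𝓝 M)) :
    M - Real.eulerMascheroniConstant + logZetaRemainder 1 = 0 := by
  have hzeta : Tendsto (fun δ : ℝ => Real.log (riemannZeta ((1 + δ : ℝ) : ℂ)).re + Real.log δ)
      (𝓝[>] 0) (𝓝 0) := by
    have h := ((isLittleO_one_iff ℝ).1 log_riemannZeta_add_log_sub_isLittleO_ofReal).comp
      tendsto_one_add_nhdsGT_zero
    exact h.congr fun δ => by simp
  have hremainder : Tendsto (fun δ : ℝ => logZetaRemainder (1 + δ)) (𝓝[>] 0)
      (𝓝 (logZetaRemainder 1)) :=
    ((continuousOn_logZetaRemainder 1 Set.self_mem_Ici).mono_left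
      (nhdsWithin_mono _ Set.Ioi_subset_Ici_self)).comp tendsto_one_add_nhdsGT_zero
  have h := ((tendsto_tsum_primes_rpow_add_log hM).add hremainder).sub
    (hzeta.add tendsto_log_one_sub_exp_neg_sub_log)
  rw [add_zero, sub_zero] at h
  refine tendsto_nhds_unique h (tendsto_const_nhds.congr' ?_)
  filter_upwards [self_mem_nhdsWithin] with δ (hδ : 0 < δ)
  rw [log_riemannZeta_eq_tsum_primes_add (by linarith)]
  ring

theorem tendsto_sum_primesLE {E : Type*} [AddCommMonoid E] [TopologicalSpace E] {f : ℕ → E}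
    {a : E} (h : HasSum (fun p : Nat.Primes => f p) a) :
    Tendsto (fun N : ℕ => ∑ p ∈ N.primesLE, f p) atTop (𝓝 a) := by
  have hrange := (Nat.Primes.hasSum_iff_hasSum_ite f).1 h |>.tendsto_sum_nat
  refine (hrange.comp (tendsto_add_atTop_nat 1)).congr fun N => ?_
  rw [Function.comp_apply, Nat.primesLE_eq_filter_range, Finset.sum_filter]

theorem tendsto_sum_primes_neg_log_sub_log_log :
    Tendsto (fun N : ℕ => ∑ p ∈ N.primesLE, -Real.log (1 - (p : ℝ)⁻¹) - Real.log (Real.log N))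
      atTop (𝓝 Real.eulerMascheroniConstant) := by
  obtain ⟨M, hM⟩ := exists_tendsto_sum_primes_inv_sub_log_log
  have h := hM.add (tendsto_sum_primesLE (hasSum_logZetaRemainder le_rfl)
    (f := fun n : ℕ => -Real.log (1 - (n : ℝ) ^ (-1 : ℝ)) - (n : ℝ) ^ (-1 : ℝ)))
  rw [show M + logZetaRemainder 1 = Real.eulerMascheroniConstant by
    linarith [sub_eulerMascheroniConstant_add_logZetaRemainder_one hM]] at h
  refine h.congr fun N => ?_
  simp only [Real.rpow_neg_one, Finset.sum_sub_distrib]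
  ring

end MertensThird

/-! ### Möbius inversion of the logarithm -/

section MoebiusInversion

theorem hasSum_pow_div_pnat {z : ℂ} (hz : ‖z‖ < 1) :
    HasSum (fun j : ℕ+ => z ^ (j : ℕ) / ((j : ℕ) : ℂ)) (-Complex.log (1 - z)) := by
  refine (PNat.coe_injective.hasSum_iff (f := fun n : ℕ => z ^ n / (n : ℂ)) fun n hn => ?_).2
    (Complex.hasSum_taylorSeries_neg_log hz)
  rcases Nat.eq_zero_or_pos n with rfl | hpos
  · simp
  · exact absurd ⟨⟨n, hpos⟩, rfl⟩ hn

theorem norm_moebius_div_mul_le (k : ℕ+) (w : ℂ) :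
    ‖((ArithmeticFunction.moebius (k : ℕ) : ℤ) : ℂ) / ((k : ℕ) : ℂ) * w‖ ≤ ‖w‖ := by
  rw [norm_mul, norm_div, Complex.norm_intCast, Complex.norm_natCast]
  refine mul_le_of_le_one_left (norm_nonneg _) (div_le_one_of_le₀ ?_ (Nat.cast_nonneg _))
  have hmoebius : |((ArithmeticFunction.moebius (k : ℕ) : ℤ) : ℝ)| ≤ 1 := by
    exact_mod_cast ArithmeticFunction.abs_moebius_le_one
  exact hmoebius.trans (by exact_mod_cast k.2)

/-- The term of index `(k, j)` of the double series obtained from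
`∑ₖ (μ(k) / k) (-log (1 - z ^ k))` by expanding the logarithms. -/
noncomputable def moebiusPowTerm (z : ℂ) (x : ℕ+ × ℕ+) : ℂ :=
  ((ArithmeticFunction.moebius (x.1 : ℕ) : ℤ) : ℂ) / ((x.1 : ℕ) : ℂ) *
    ((z ^ (x.1 : ℕ)) ^ (x.2 : ℕ) / ((x.2 : ℕ) : ℂ))

variable {z : ℂ}

theorem summable_moebiusPowTerm (hz : ‖z‖ < 1) : Summable (moebiusPowTerm z) := by
  refine Summable.of_norm_bounded (summable_prod_mul_pow 0 (r := ‖z‖) (by simpa using hz))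
    fun x => (norm_moebius_div_mul_le _ _).trans ?_
  rw [norm_div, norm_pow, norm_pow, Complex.norm_natCast, pow_zero, one_mul, ← pow_mul]
  exact div_le_self (by positivity) (by exact_mod_cast x.2.2)

theorem moebiusPowTerm_eq (z : ℂ) (x : ℕ+ × ℕ+) :
    moebiusPowTerm z x = ((ArithmeticFunction.moebius (x.1 : ℕ) : ℤ) : ℂ) *
      (z ^ ((x.1 : ℕ) * x.2) / (((x.1 : ℕ) * x.2 : ℕ) : ℂ)) := by
  rw [moebiusPowTerm, div_mul_div_comm, ← pow_mul, mul_div_assoc, Nat.cast_mul]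

theorem sum_divisorsAntidiagonal_moebiusPowTerm (z : ℂ) (n : ℕ+) :
    ∑ x : (n : ℕ).divisorsAntidiagonal, moebiusPowTerm z (sigmaAntidiagonalEquivProd ⟨n, x⟩) =
      if n = 1 then z else 0 := by
  have hterm (x : (n : ℕ).divisorsAntidiagonal) :
      moebiusPowTerm z (sigmaAntidiagonalEquivProd ⟨n, x⟩) =
        ((ArithmeticFunction.moebius x.1.1 : ℤ) : ℂ) * (z ^ (n : ℕ) / ((n : ℕ) : ℂ)) := by
    have hx : x.1.1 * x.1.2 = n := (Nat.mem_divisorsAntidiagonal.1 x.2).1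
    rw [moebiusPowTerm_eq]
    change _ * (z ^ (x.1.1 * x.1.2) / ((x.1.1 * x.1.2 : ℕ) : ℂ)) = _
    rw [hx]
    rfl
  have hmoebius : ∑ x : (n : ℕ).divisorsAntidiagonal,
      ((ArithmeticFunction.moebius x.1.1 : ℤ) : ℂ) = if n = 1 then 1 else 0 := by
    rw [Finset.sum_coe_sort (n : ℕ).divisorsAntidiagonal
        fun x => ((ArithmeticFunction.moebius x.1 : ℤ) : ℂ),
      Nat.sum_divisorsAntidiagonal fun i _ => ((ArithmeticFunction.moebius i : ℤ) : ℂ),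
      ← Int.cast_sum, ← ArithmeticFunction.coe_mul_zeta_apply,
      ArithmeticFunction.moebius_mul_coe_zeta, ArithmeticFunction.one_apply]
    simp
  rw [Finset.sum_congr rfl fun x _ => hterm x, ← Finset.sum_mul, hmoebius]
  split_ifs with hn <;> simp [hn]

theorem hasSum_moebiusPowTerm (hz : ‖z‖ < 1) : HasSum (moebiusPowTerm z) z := by
  rw [← sigmaAntidiagonalEquivProd.hasSum_iff]
  have hsum := (sigmaAntidiagonalEquivProd.summable_iff.2 (summable_moebiusPowTerm hz)).hasSum
  have hfiber := hsum.sigma fun n => hasSum_fintype _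
  simp only [Function.comp_apply, sum_divisorsAntidiagonal_moebiusPowTerm] at hfiber
  have htsum : ∑' x, (moebiusPowTerm z ∘ sigmaAntidiagonalEquivProd) x = z :=
    hfiber.unique (hasSum_ite_eq 1 z)
  rwa [htsum] at hsum

theorem hasSum_moebius_div_mul_neg_log (hz : ‖z‖ < 1) :
    HasSum (fun k : ℕ+ => ((ArithmeticFunction.moebius (k : ℕ) : ℤ) : ℂ) / ((k : ℕ) : ℂ) *
      -Complex.log (1 - z ^ (k : ℕ))) z := by
  have hfiber (k : ℕ+) : HasSum (fun j : ℕ+ => moebiusPowTerm z (k, j))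
      (((ArithmeticFunction.moebius (k : ℕ) : ℤ) : ℂ) / ((k : ℕ) : ℂ) *
        -Complex.log (1 - z ^ (k : ℕ))) := by
    have hk : ‖z ^ (k : ℕ)‖ < 1 := by
      rw [norm_pow]
      exact pow_lt_one₀ (norm_nonneg _) hz k.ne_zero
    simp only [moebiusPowTerm]
    exact (hasSum_pow_div_pnat hk).mul_left
      (((ArithmeticFunction.moebius (k : ℕ) : ℤ) : ℂ) / ((k : ℕ) : ℂ))
  exact (hasSum_moebiusPowTerm hz).prod_fiberwise hfiber

end MoebiusInversion

/-! ### Truncated Euler products -/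

section EulerTail

/-- The primes `p` with `B < p ≤ N`, over which the truncated Euler products of cutoff `B` run. -/
noncomputable def primesBetween (B : ℝ) (N : ℕ) : Finset ℕ :=
  (Finset.Iic N).filter fun p : ℕ => p.Prime ∧ B < (p : ℝ)

theorem prime_of_mem_primesBetween {B : ℝ} {N p : ℕ} (hp : p ∈ primesBetween B N) : p.Prime :=
  (Finset.mem_filter.1 hp).2.1

theorem lt_of_mem_primesBetween {B : ℝ} {N p : ℕ} (hp : p ∈ primesBetween B N) : B < p :=
  (Finset.mem_filter.1 hp).2.2

theorem sum_primesUpTo_add_sum_primesBetween {M : Type*} [AddCommMonoid M] (f : ℕ → M) {B : ℝ}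
    {N : ℕ} (hN : ⌊B⌋₊ ≤ N) :
    ∑ p ∈ primesUpTo B, f p + ∑ p ∈ primesBetween B N, f p = ∑ p ∈ N.primesLE, f p := by
  have hle {p : ℕ} (hp : p.Prime) : p ≤ ⌊B⌋₊ ↔ (p : ℝ) ≤ B := Nat.le_floor_iff' hp.ne_zero
  rw [← Finset.sum_filter_add_sum_filter_not N.primesLE (fun p : ℕ => (p : ℝ) ≤ B)]
  congr 2 <;> ext p <;>
    simp only [primesUpTo, primesBetween, Nat.mem_primesLE, Finset.mem_filter, Finset.mem_Iic,
      not_le]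
  · refine ⟨fun ⟨hpB, hp⟩ => ⟨⟨hpB.trans hN, hp⟩, (hle hp).1 hpB⟩,
      fun ⟨⟨_, hp⟩, hpB⟩ => ⟨(hle hp).2 hpB, hp⟩⟩
  · exact and_assoc.symm

theorem tendsto_sum_primesBetween {E : Type*} [AddCommGroup E] [TopologicalSpace E]
    [ContinuousSub E] {f : ℕ → E} {l : E}
    (h : Tendsto (fun N : ℕ => ∑ p ∈ N.primesLE, f p) atTop (𝓝 l)) (B : ℝ) :
    Tendsto (fun N => ∑ p ∈ primesBetween B N, f p) atTop (𝓝 (l - ∑ p ∈ primesUpTo B, f p)) := by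
  refine (h.sub tendsto_const_nhds).congr' ?_
  filter_upwards [eventually_ge_atTop ⌊B⌋₊] with N hN
  rw [← sum_primesUpTo_add_sum_primesBetween f hN, add_sub_cancel_left]

variable {q : ℕ} (χ : DirichletCharacter ℂ q) (B : ℝ)

theorem norm_char_div_natCast_pow_le (n s : ℕ) :
    ‖χ (n : ZMod q) / (n : ℂ) ^ s‖ ≤ ((n : ℝ)⁻¹) ^ s := by
  rw [norm_div, norm_pow, Complex.norm_natCast, inv_pow, div_eq_mul_inv]
  exact mul_le_of_le_one_left (by positivity) (χ.norm_le_one _)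

variable {s : ℕ}

theorem norm_char_div_prime_pow_le_inv {p : ℕ} (hp : p.Prime) (hs : s ≠ 0) :
    ‖χ (p : ZMod q) / (p : ℂ) ^ s‖ ≤ (p : ℝ)⁻¹ :=
  (norm_char_div_natCast_pow_le χ p s).trans
    (pow_le_of_le_one (by positivity) ((prime_inv_le_half hp).trans (by norm_num)) hs)

theorem norm_char_div_prime_pow_le_half {p : ℕ} (hp : p.Prime) (hs : s ≠ 0) :
    ‖χ (p : ZMod q) / (p : ℂ) ^ s‖ ≤ 1 / 2 :=
  (norm_char_div_prime_pow_le_inv χ hp hs).trans (prime_inv_le_half hp)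

theorem one_sub_char_div_prime_pow_ne_zero {p : ℕ} (hp : p.Prime) (hs : s ≠ 0) :
    1 - χ (p : ZMod q) / (p : ℂ) ^ s ≠ 0 := by
  intro h
  have hle := norm_char_div_prime_pow_le_half χ hp hs
  rw [← sub_eq_zero.1 h, norm_one] at hle
  norm_num at hle

theorem logEulerTailPartial_natCast (s N : ℕ) : logEulerTailPartial χ B (s : ℂ) N =
    ∑ p ∈ primesBetween B N, -Complex.log (1 - χ (p : ZMod q) / (p : ℂ) ^ s) := by
  simp only [logEulerTailPartial, primesBetween, Complex.cpow_natCast, Finset.sum_neg_distrib]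

theorem exp_logEulerTailPartial (hs : s ≠ 0) (N : ℕ) :
    Complex.exp (logEulerTailPartial χ B (s : ℂ) N) = eulerTailPartial χ B (s : ℂ) N := by
  rw [logEulerTailPartial_natCast, Complex.exp_sum, eulerTailPartial]
  refine Finset.prod_congr rfl fun p hp => ?_
  rw [Complex.exp_neg, Complex.exp_log
    (one_sub_char_div_prime_pow_ne_zero χ (prime_of_mem_primesBetween hp) hs),
    Complex.cpow_natCast]

theorem summable_primes_neg_log_one_sub_char_div_pow_sub (hs : s ≠ 0) :
    Summable fun p : Nat.Primes =>
      -Complex.log (1 - χ ((p : ℕ) : ZMod q) / ((p : ℕ) : ℂ) ^ s) -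
        χ ((p : ℕ) : ZMod q) / ((p : ℕ) : ℂ) ^ s := by
  refine Summable.of_norm_bounded summable_primes_inv_sq fun p => ?_
  refine (norm_neg_log_one_sub_sub_le (norm_char_div_prime_pow_le_half χ p.2 hs)).trans ?_
  gcongr
  exact norm_char_div_prime_pow_le_inv χ p.2 hs

variable [NeZero q] {χ}

theorem exists_tendsto_sum_primes_char_div_pow (hs : s ≠ 0) (hχ : s = 1 → χ ≠ 1) :
    ∃ l, Tendsto (fun N : ℕ => ∑ p ∈ N.primesLE, χ (p : ZMod q) / (p : ℂ) ^ s) atTop (𝓝 l) := by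
  rcases eq_or_ne s 1 with rfl | hs1
  · simpa only [pow_one] using exists_tendsto_sum_primes_char_div (hχ rfl)
  · have hsum : Summable fun p : Nat.Primes =>
        χ ((p : ℕ) : ZMod q) / ((p : ℕ) : ℂ) ^ s := by
      refine Summable.of_norm_bounded summable_primes_inv_sq fun p => ?_
      exact (norm_char_div_natCast_pow_le χ p s).trans (pow_le_pow_of_le_one (by positivity)
        ((prime_inv_le_half p.2).trans (by norm_num)) (by omega))
    exact ⟨_, tendsto_sum_primesLE (f := fun n => χ (n : ZMod q) / (n : ℂ) ^ s) hsum.hasSum⟩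

theorem tendsto_logEulerTailPartial (hs : s ≠ 0) (hχ : s = 1 → χ ≠ 1) :
    Tendsto (logEulerTailPartial χ B (s : ℂ)) atTop (𝓝 (logEulerTail χ B (s : ℂ))) := by
  obtain ⟨l, hl⟩ := exists_tendsto_sum_primes_char_div_pow hs hχ
  have hlog := hl.add (tendsto_sum_primesLE
    (f := fun n => -Complex.log (1 - χ (n : ZMod q) / (n : ℂ) ^ s) - χ (n : ZMod q) / (n : ℂ) ^ s)
    (summable_primes_neg_log_one_sub_char_div_pow_sub χ hs).hasSum)
  simp only [← Finset.sum_add_distrib, add_sub_cancel] at hlog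
  have htail := tendsto_sum_primesBetween hlog B
  simp only [← logEulerTailPartial_natCast] at htail
  exact tendsto_nhds_limUnder ⟨_, htail⟩

theorem tendsto_eulerTailPartial_exp_logEulerTail (hs : s ≠ 0) (hχ : s = 1 → χ ≠ 1) :
    Tendsto (eulerTailPartial χ B (s : ℂ)) atTop
      (𝓝 (Complex.exp (logEulerTail χ B (s : ℂ)))) :=
  (tendsto_logEulerTailPartial B hs hχ).cexp.congr (exp_logEulerTailPartial χ B hs)

theorem exp_logEulerTail (hs : s ≠ 0) (hχ : s = 1 → χ ≠ 1) :
    Complex.exp (logEulerTail χ B (s : ℂ)) = eulerTail χ B (s : ℂ) :=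
  (tendsto_eulerTailPartial_exp_logEulerTail B hs hχ).limUnder_eq.symm

theorem tendsto_eulerTailPartial (hs : s ≠ 0) (hχ : s = 1 → χ ≠ 1) :
    Tendsto (eulerTailPartial χ B (s : ℂ)) atTop (𝓝 (eulerTail χ B (s : ℂ))) :=
  tendsto_nhds_limUnder ⟨_, tendsto_eulerTailPartial_exp_logEulerTail B hs hχ⟩

end EulerTail

/-! ### The double series -/

section DoubleSeries

theorem pow_ne_one_of_mul_eq_one {M : Type*} [Monoid M] {x : M} (hx : x ≠ 1) {k m : ℕ}
    (h : k * m = 1) : x ^ k ≠ 1 := by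
  rwa [Nat.eq_one_of_mul_eq_one_right h, pow_one]

variable {q : ℕ} (χ : DirichletCharacter ℂ q) (B : ℝ)

theorem norm_neg_log_one_sub_char_div_prime_pow_le {p s : ℕ} (hp : p.Prime) (hs : 2 ≤ s) :
    ‖-Complex.log (1 - χ (p : ZMod q) / (p : ℂ) ^ s)‖ ≤ 6 * ((p : ℝ)⁻¹) ^ 2 * (1 / 2) ^ s := by
  obtain ⟨t, rfl⟩ := Nat.exists_eq_add_of_le hs
  set w := χ (p : ZMod q) / (p : ℂ) ^ (2 + t)
  have hwhalf : ‖-w‖ ≤ 1 / 2 := by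
    rw [norm_neg]
    exact norm_char_div_prime_pow_le_half χ hp (by omega)
  calc ‖-Complex.log (1 - w)‖ ≤ 3 / 2 * ‖w‖ := by
        rw [norm_neg, sub_eq_add_neg, ← norm_neg w]
        exact Complex.norm_log_one_add_half_le_self hwhalf
    _ ≤ 3 / 2 * (((p : ℝ)⁻¹) ^ 2 * ((p : ℝ)⁻¹) ^ t) := by
        rw [← pow_add]
        gcongr
        exact norm_char_div_natCast_pow_le χ p _
    _ ≤ 3 / 2 * (((p : ℝ)⁻¹) ^ 2 * (1 / 2) ^ t) := by
        gcongr
        exact prime_inv_le_half hp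
    _ = 6 * ((p : ℝ)⁻¹) ^ 2 * (1 / 2) ^ (2 + t) := by ring

theorem norm_logEulerTailPartial_le {s : ℕ} (hs : 2 ≤ s) (N : ℕ) :
    ‖logEulerTailPartial χ B (s : ℂ) N‖ ≤ 6 * (∑' n : ℕ, ((n : ℝ)⁻¹) ^ 2) * (1 / 2) ^ s := by
  rw [logEulerTailPartial_natCast, ← tsum_mul_left, ← tsum_mul_right]
  refine (norm_sum_le_of_le _ fun p hp => norm_neg_log_one_sub_char_div_prime_pow_le χ
    (prime_of_mem_primesBetween hp) hs).trans ?_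
  exact ((summable_natCast_inv_sq.mul_left 6).mul_right _).sum_le_tsum _ fun n _ => by positivity

/-- The partial sum over the primes `B < p ≤ N` of `moebiusTerm χ B m k`. The uniform bounds that
justify exchanging `N → ∞` with the series over `k` and `m` are bounds on these partial sums. -/
noncomputable def moebiusTermPartial (m k : ℕ+) (N : ℕ) : ℂ :=
  ((ArithmeticFunction.moebius (k : ℕ) : ℤ) : ℂ) / ((k : ℕ) : ℂ) *
    logEulerTailPartial (χ ^ (k : ℕ)) B (((k : ℕ) * (m : ℕ) : ℕ) : ℂ) N

theorem hasSum_moebiusTermPartial (m : ℕ+) (N : ℕ) :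
    HasSum (fun k => moebiusTermPartial χ B m k N)
      (∑ p ∈ primesBetween B N, χ (p : ZMod q) / (p : ℂ) ^ (m : ℕ)) := by
  have hinv := hasSum_sum (s := primesBetween B N) fun p hp =>
    hasSum_moebius_div_mul_neg_log (z := χ (p : ZMod q) / (p : ℂ) ^ (m : ℕ))
      ((norm_char_div_prime_pow_le_half χ (prime_of_mem_primesBetween hp) m.ne_zero).trans_lt
        one_half_lt_one)
  refine hinv.congr_fun fun k => ?_
  rw [moebiusTermPartial, logEulerTailPartial_natCast, Finset.mul_sum]
  refine Finset.sum_congr rfl fun p _ => ?_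
  rw [MulChar.pow_apply' _ k.ne_zero, div_pow, ← pow_mul, mul_comm (m : ℕ)]

theorem hasSum_one_div_mul_sum_primesBetween (N : ℕ) :
    HasSum (fun m : ℕ+ => 1 / ((m : ℕ) : ℂ) *
      ∑ p ∈ primesBetween B N, χ (p : ZMod q) / (p : ℂ) ^ (m : ℕ))
      (∑ p ∈ primesBetween B N, χ (p : ZMod q) * ((-Real.log (1 - (p : ℝ)⁻¹) : ℝ) : ℂ)) := by
  have hlog (p : ℕ) (hp : p ∈ primesBetween B N) :
      HasSum (fun m : ℕ+ => χ (p : ZMod q) * (((p : ℂ)⁻¹) ^ (m : ℕ) / ((m : ℕ) : ℂ)))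
        (χ (p : ZMod q) * ((-Real.log (1 - (p : ℝ)⁻¹) : ℝ) : ℂ)) := by
    have hhalf := prime_inv_le_half (prime_of_mem_primesBetween hp)
    have hnorm : ‖(p : ℂ)⁻¹‖ < 1 := by
      rw [norm_inv, Complex.norm_natCast]
      linarith
    rw [Complex.ofReal_neg, Complex.ofReal_log (by linarith)]
    push_cast
    exact (hasSum_pow_div_pnat hnorm).mul_left _
  refine (hasSum_sum hlog).congr_fun fun m => ?_
  rw [Finset.mul_sum]
  refine Finset.sum_congr rfl fun p _ => ?_
  rw [inv_pow]
  ring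

theorem summable_pnat_half_pow : Summable fun k : ℕ+ => (1 / 2 : ℝ) ^ (k : ℕ) :=
  summable_geometric_two.comp_injective PNat.coe_injective

theorem half_pow_mul_le (k m : ℕ+) :
    (1 / 2 : ℝ) ^ ((k : ℕ) * (m : ℕ)) ≤ 2 * ((1 / 2) ^ (k : ℕ) * (1 / 2) ^ (m : ℕ)) := by
  have hkm : (k : ℕ) + m ≤ (k : ℕ) * m + 1 := by nlinarith [k.pos, m.pos]
  calc (1 / 2 : ℝ) ^ ((k : ℕ) * (m : ℕ)) = 2 * (1 / 2) ^ ((k : ℕ) * (m : ℕ) + 1) := by ring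
    _ ≤ 2 * (1 / 2) ^ ((k : ℕ) + (m : ℕ)) := by
        gcongr ?_ * ?_
        exact pow_le_pow_of_le_one (by norm_num) (by norm_num) hkm
    _ = 2 * ((1 / 2) ^ (k : ℕ) * (1 / 2) ^ (m : ℕ)) := by rw [pow_add]

theorem norm_one_div_pnat_mul_le (m : ℕ+) (w : ℂ) : ‖1 / ((m : ℕ) : ℂ) * w‖ ≤ ‖w‖ := by
  rw [norm_mul, norm_div, norm_one, Complex.norm_natCast]
  exact mul_le_of_le_one_left (norm_nonneg _)
    (div_le_one_of_le₀ (by exact_mod_cast m.2) (Nat.cast_nonneg _))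

variable [NeZero q] {χ}

theorem tendsto_logEulerTailPartial_pow (hχ : χ ≠ 1) (k m : ℕ+) :
    Tendsto (logEulerTailPartial (χ ^ (k : ℕ)) B (((k : ℕ) * (m : ℕ) : ℕ) : ℂ)) atTop
      (𝓝 (logEulerTail (χ ^ (k : ℕ)) B (((k : ℕ) * (m : ℕ) : ℕ) : ℂ))) :=
  tendsto_logEulerTailPartial B (k * m).ne_zero (pow_ne_one_of_mul_eq_one hχ)

theorem tendsto_eulerTailPartial_pow (hχ : χ ≠ 1) (k m : ℕ+) :
    Tendsto (eulerTailPartial (χ ^ (k : ℕ)) B (((k : ℕ) * (m : ℕ) : ℕ) : ℂ)) atTop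
      (𝓝 (eulerTail (χ ^ (k : ℕ)) B (((k : ℕ) * (m : ℕ) : ℕ) : ℂ))) :=
  tendsto_eulerTailPartial B (k * m).ne_zero (pow_ne_one_of_mul_eq_one hχ)

theorem exp_logEulerTail_pow (hχ : χ ≠ 1) (k m : ℕ+) :
    Complex.exp (logEulerTail (χ ^ (k : ℕ)) B (((k : ℕ) * (m : ℕ) : ℕ) : ℂ)) =
      eulerTail (χ ^ (k : ℕ)) B (((k : ℕ) * (m : ℕ) : ℕ) : ℂ) :=
  exp_logEulerTail B (k * m).ne_zero (pow_ne_one_of_mul_eq_one hχ)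

theorem tendsto_moebiusTermPartial (hχ : χ ≠ 1) (m k : ℕ+) :
    Tendsto (moebiusTermPartial χ B m k) atTop (𝓝 (moebiusTerm χ B m k)) :=
  (tendsto_logEulerTailPartial_pow B hχ k m).const_mul _

theorem exists_norm_logEulerTailPartial_pow_le (hχ : χ ≠ 1) :
    ∃ C, 0 ≤ C ∧ ∀ (k m : ℕ+) (N : ℕ),
      ‖logEulerTailPartial (χ ^ (k : ℕ)) B (((k : ℕ) * (m : ℕ) : ℕ) : ℂ) N‖ ≤
        C * (1 / 2) ^ ((k : ℕ) * (m : ℕ)) := by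
  obtain ⟨D, hD⟩ := (tendsto_logEulerTailPartial B one_ne_zero fun _ => hχ).norm.bddAbove_range
  set S := ∑' n : ℕ, ((n : ℝ)⁻¹) ^ 2
  have hS : 0 ≤ S := tsum_nonneg fun n => by positivity
  have hD0 : 0 ≤ D := (norm_nonneg _).trans (hD ⟨0, rfl⟩)
  refine ⟨6 * S + 2 * D, by positivity, fun k m N => ?_⟩
  rcases eq_or_ne ((k : ℕ) * (m : ℕ)) 1 with hkm | hkm
  · have hDN : ‖logEulerTailPartial χ B ((1 : ℕ) : ℂ) N‖ ≤ D := hD ⟨N, rfl⟩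
    rw [hkm, Nat.eq_one_of_mul_eq_one_right hkm, pow_one, pow_one]
    exact hDN.trans (by linarith)
  · have hpos : 0 < (k : ℕ) * (m : ℕ) := (k * m).pos
    refine (norm_logEulerTailPartial_le _ B (by omega) N).trans ?_
    gcongr
    linarith

theorem exists_norm_moebiusTermPartial_le (hχ : χ ≠ 1) :
    ∃ C, ∀ (m k : ℕ+) (N : ℕ),
      ‖moebiusTermPartial χ B m k N‖ ≤ C * (1 / 2) ^ (m : ℕ) * (1 / 2) ^ (k : ℕ) := by
  obtain ⟨C, hC, hle⟩ := exists_norm_logEulerTailPartial_pow_le B hχ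
  refine ⟨2 * C, fun m k N => ?_⟩
  calc ‖moebiusTermPartial χ B m k N‖ ≤ C * (1 / 2) ^ ((k : ℕ) * (m : ℕ)) :=
        (norm_moebius_div_mul_le k _).trans (hle k m N)
    _ ≤ C * (2 * ((1 / 2) ^ (k : ℕ) * (1 / 2) ^ (m : ℕ))) := by
        gcongr
        exact half_pow_mul_le k m
    _ = 2 * C * (1 / 2) ^ (m : ℕ) * (1 / 2) ^ (k : ℕ) := by ring

theorem summable_moebiusTerm (hχ : χ ≠ 1) (m : ℕ+) : Summable (moebiusTerm χ B m) := by
  obtain ⟨C, hC⟩ := exists_norm_moebiusTermPartial_le B hχ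
  exact Summable.of_norm_bounded (summable_pnat_half_pow.mul_left (C * (1 / 2) ^ (m : ℕ)))
    fun k => le_of_tendsto' (tendsto_moebiusTermPartial B hχ m k).norm fun N => hC m k N

theorem tendsto_sum_primesBetween_char_div_pow (hχ : χ ≠ 1) (m : ℕ+) :
    Tendsto (fun N => ∑ p ∈ primesBetween B N, χ (p : ZMod q) / (p : ℂ) ^ (m : ℕ)) atTop
      (𝓝 (∑' k : ℕ+, moebiusTerm χ B m k)) := by
  obtain ⟨C, hC⟩ := exists_norm_moebiusTermPartial_le B hχ
  refine (tendsto_tsum_of_dominated_convergence (summable_pnat_half_pow.mul_left _)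
    (tendsto_moebiusTermPartial B hχ m)
    (Eventually.of_forall fun N k => hC m k N)).congr fun N => ?_
  exact (hasSum_moebiusTermPartial χ B m N).tsum_eq

theorem exists_norm_sum_primesBetween_char_div_pow_le (hχ : χ ≠ 1) :
    ∃ C : ℝ, ∀ (m : ℕ+) (N : ℕ),
      ‖∑ p ∈ primesBetween B N, χ (p : ZMod q) / (p : ℂ) ^ (m : ℕ)‖ ≤ C * (1 / 2) ^ (m : ℕ) := by
  obtain ⟨C, hC⟩ := exists_norm_moebiusTermPartial_le B hχ
  refine ⟨C * ∑' k : ℕ+, (1 / 2 : ℝ) ^ (k : ℕ), fun m N => ?_⟩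
  rw [← (hasSum_moebiusTermPartial χ B m N).tsum_eq, mul_right_comm]
  exact tsum_of_norm_bounded (summable_pnat_half_pow.hasSum.mul_left _) fun k => hC m k N

theorem summable_one_div_mul_tsum_moebiusTerm (hχ : χ ≠ 1) :
    Summable fun m : ℕ+ => 1 / ((m : ℕ) : ℂ) * ∑' k : ℕ+, moebiusTerm χ B m k := by
  obtain ⟨C, hC⟩ := exists_norm_sum_primesBetween_char_div_pow_le B hχ
  refine Summable.of_norm_bounded (summable_pnat_half_pow.mul_left C) fun m => ?_
  exact (norm_one_div_pnat_mul_le m _).trans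
    (le_of_tendsto' (tendsto_sum_primesBetween_char_div_pow B hχ m).norm (hC m))

theorem tendsto_sum_primesBetween_char_mul_neg_log (hχ : χ ≠ 1) :
    Tendsto (fun N => ∑ p ∈ primesBetween B N,
      χ (p : ZMod q) * ((-Real.log (1 - (p : ℝ)⁻¹) : ℝ) : ℂ)) atTop
      (𝓝 (∑' m : ℕ+, 1 / ((m : ℕ) : ℂ) * ∑' k : ℕ+, moebiusTerm χ B m k)) := by
  obtain ⟨C, hC⟩ := exists_norm_sum_primesBetween_char_div_pow_le B hχ
  refine (tendsto_tsum_of_dominated_convergence (summable_pnat_half_pow.mul_left C)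
    (fun m => (tendsto_sum_primesBetween_char_div_pow B hχ m).const_mul _)
    (Eventually.of_forall fun N m =>
      (norm_one_div_pnat_mul_le m _).trans (hC m N))).congr fun N => ?_
  exact (hasSum_one_div_mul_sum_primesBetween χ B N).tsum_eq

end DoubleSeries

/-! ### Orthogonality of characters -/

section Orthogonality

variable {q : ℕ} [NeZero q]

open scoped Classical in
theorem sum_ne_one_conj_char_mul_char {a b : ZMod q} (ha : IsUnit a) (hb : IsUnit b) :
    ∑ χ : DirichletCharacter ℂ q with χ ≠ 1, (starRingEnd ℂ) (χ a) * χ b =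
      (if a = b then (q.totient : ℂ) else 0) - 1 := by
  have hconj (χ : DirichletCharacter ℂ q) : (starRingEnd ℂ) (χ a) = χ a⁻¹ := by
    rw [starRingEnd_apply, MulChar.star_apply', MulChar.inv_apply_eq_inv']
    refine inv_eq_of_mul_eq_one_left ?_
    rw [← map_mul, ZMod.inv_mul_of_unit _ ha, map_one]
  have hall := DirichletCharacter.sum_char_inv_mul_char_eq ℂ ha b
  simp only [← hconj] at hall
  rw [← hall, ← Finset.sum_filter_add_sum_filter_not Finset.univ (· ≠ 1)]
  simp [Finset.filter_eq', MulChar.one_apply ha, MulChar.one_apply hb]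

open scoped Classical in
theorem sum_conj_char_mul_char_eq_mertensExp {a : ℤ} (ha : IsCoprime a (q : ℤ)) {p : ℕ}
    (hp : p.Coprime q) :
    ∑ χ : DirichletCharacter ℂ q with χ ≠ 1, (starRingEnd ℂ) (χ (a : ZMod q)) * χ (p : ZMod q) =
      ((mertensExp q a p : ℤ) : ℂ) := by
  have haq : IsUnit (a : ZMod q) := by
    rwa [ZMod.coe_int_isUnit_iff_isCoprime, isCoprime_comm]
  have hmod : (a : ZMod q) = (p : ZMod q) ↔ (p : ℤ) ≡ a [ZMOD (q : ℤ)] := by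
    rw [← ZMod.intCast_eq_intCast_iff, Int.cast_natCast, eq_comm]
  rw [sum_ne_one_conj_char_mul_char haq ((ZMod.isUnit_iff_coprime p q).2 hp), mertensExp]
  simp only [hmod]
  split_ifs <;> simp

open scoped Classical in
theorem tendsto_sum_primesBetween_mertensExp_mul_neg_log {a : ℤ} (ha : IsCoprime a (q : ℤ))
    {B : ℝ} (hB : ∀ p : ℕ, p.Prime → p ∣ q → (p : ℝ) ≤ B) :
    Tendsto (fun N => ((∑ p ∈ primesBetween B N,
      (mertensExp q a p : ℝ) * -Real.log (1 - (p : ℝ)⁻¹) : ℝ) : ℂ)) atTop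
      (𝓝 (∑ χ : DirichletCharacter ℂ q with χ ≠ 1, (starRingEnd ℂ) (χ (a : ZMod q)) *
        ∑' m : ℕ+, 1 / ((m : ℕ) : ℂ) * ∑' k : ℕ+, moebiusTerm χ B m k)) := by
  have hchar := tendsto_finsetSum (Finset.univ.filter fun χ : DirichletCharacter ℂ q => χ ≠ 1)
    fun χ hχ => (tendsto_sum_primesBetween_char_mul_neg_log B
      (Finset.mem_filter.1 hχ).2).const_mul ((starRingEnd ℂ) (χ (a : ZMod q)))
  refine hchar.congr fun N => ?_
  simp only [Finset.mul_sum, ← mul_assoc]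
  rw [Finset.sum_comm, Complex.ofReal_sum]
  refine Finset.sum_congr rfl fun p hp => ?_
  have hprime := prime_of_mem_primesBetween hp
  have hpq : p.Coprime q := (Nat.Prime.coprime_iff_not_dvd hprime).2 fun hdvd =>
    (lt_of_mem_primesBetween hp).not_ge (hB p hprime hdvd)
  rw [← Finset.sum_mul, sum_conj_char_mul_char_eq_mertensExp ha hpq, Complex.ofReal_mul,
    Complex.ofReal_intCast]

end Orthogonality

/-! ### The Mertens constant -/

section MertensConst

theorem primesUpTo_eq_primesLE (x : ℝ) : primesUpTo x = ⌊x⌋₊.primesLE := by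
  ext p
  simp [primesUpTo, Nat.mem_primesLE]

theorem one_sub_one_div_prime_pos {p : ℕ} (hp : p.Prime) : 0 < 1 - 1 / (p : ℝ) := by
  rw [one_div]
  linarith [prime_inv_le_half hp]

theorem one_sub_one_div_pos_of_mem_primesUpTo {x : ℝ} {p : ℕ} (hp : p ∈ primesUpTo x) :
    0 < 1 - 1 / (p : ℝ) :=
  one_sub_one_div_prime_pos (Finset.mem_filter.1 hp).2

variable {q : ℕ} {a : ℤ}

theorem mertensProd_pos (q : ℕ) (a : ℤ) (x : ℝ) : 0 < mertensProd q a x :=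
  Finset.prod_pos fun _ hp =>
    one_sub_one_div_pos_of_mem_primesUpTo (Finset.mem_filter.1 hp).1

theorem log_prod_mertensExp (q : ℕ) (a : ℤ) (B : ℝ) :
    Real.log (∏ p ∈ primesUpTo B, (1 - 1 / (p : ℝ)) ^ mertensExp q a p) =
      -∑ p ∈ primesUpTo B, (mertensExp q a p : ℝ) * -Real.log (1 - (p : ℝ)⁻¹) := by
  rw [Real.log_prod fun p hp =>
    (zpow_pos (one_sub_one_div_pos_of_mem_primesUpTo hp) _).ne', ← Finset.sum_neg_distrib]
  refine Finset.sum_congr rfl fun p _ => ?_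
  rw [Real.log_zpow, one_div]
  ring

theorem totient_mul_log_mertensProd (q : ℕ) (a : ℤ) (x : ℝ) :
    (q.totient : ℝ) * Real.log (mertensProd q a x) =
      -∑ p ∈ ⌊x⌋₊.primesLE, (mertensExp q a p : ℝ) * -Real.log (1 - (p : ℝ)⁻¹) -
        ∑ p ∈ ⌊x⌋₊.primesLE, -Real.log (1 - (p : ℝ)⁻¹) := by
  rw [mertensProd, Real.log_prod fun p hp =>
    (one_sub_one_div_pos_of_mem_primesUpTo (Finset.mem_filter.1 hp).1).ne', Finset.sum_filter,
    primesUpTo_eq_primesLE, Finset.mul_sum, ← Finset.sum_neg_distrib, ← Finset.sum_sub_distrib]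
  refine Finset.sum_congr rfl fun p _ => ?_
  -- `φ(q)` times the indicator of `p ≡ a` is `α(p; q, a) + 1`.
  simp only [mertensExp, one_div]
  split_ifs <;> (push_cast; ring)

theorem tendsto_sum_primes_floor_neg_log_sub_log_log :
    Tendsto (fun x : ℝ => ∑ p ∈ ⌊x⌋₊.primesLE, -Real.log (1 - (p : ℝ)⁻¹) -
      Real.log (Real.log x)) atTop (𝓝 Real.eulerMascheroniConstant) := by
  have h := (tendsto_sum_primes_neg_log_sub_log_log.comp tendsto_nat_floor_atTop).add
    tendsto_log_log_natFloor_sub_log_log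
  rw [add_zero] at h
  refine h.congr fun x => ?_
  simp only [Function.comp_apply, sub_add_sub_cancel]

variable [NeZero q]

open scoped Classical in
theorem tendsto_ofReal_totient_mul_log_mertensProd_add_log_log (ha : IsCoprime a (q : ℤ))
    {B : ℝ} (hB : ∀ p : ℕ, p.Prime → p ∣ q → (p : ℝ) ≤ B) :
    Tendsto (fun x : ℝ => (((q.totient : ℝ) * Real.log (mertensProd q a x) +
      Real.log (Real.log x) : ℝ) : ℂ)) atTop
      (𝓝 (-(Real.eulerMascheroniConstant : ℂ) +
        ((Real.log (∏ p ∈ primesUpTo B, (1 - 1 / (p : ℝ)) ^ mertensExp q a p) : ℝ) : ℂ) -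
        ∑ χ : DirichletCharacter ℂ q with χ ≠ 1, (starRingEnd ℂ) (χ (a : ZMod q)) *
          ∑' m : ℕ+, 1 / ((m : ℕ) : ℂ) * ∑' k : ℕ+, moebiusTerm χ B m k)) := by
  have htail := (tendsto_sum_primesBetween_mertensExp_mul_neg_log ha hB).comp
    (tendsto_nat_floor_atTop (α := ℝ))
  have hmertens := tendsto_sum_primes_floor_neg_log_sub_log_log.ofReal
  refine ((hmertens.neg.add_const _).sub htail).congr' ?_
  filter_upwards [tendsto_nat_floor_atTop.eventually_ge_atTop ⌊B⌋₊] with x hx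
  rw [totient_mul_log_mertensProd, log_prod_mertensExp,
    ← sum_primesUpTo_add_sum_primesBetween
      (fun p => (mertensExp q a p : ℝ) * -Real.log (1 - (p : ℝ)⁻¹)) hx]
  simp only [Function.comp_apply]
  push_cast
  ring

theorem exists_tendsto_totient_mul_log_mertensProd_add_log_log (ha : IsCoprime a (q : ℤ)) :
    ∃ R, Tendsto (fun x : ℝ => (q.totient : ℝ) * Real.log (mertensProd q a x) +
      Real.log (Real.log x)) atTop (𝓝 R) := by
  have hq (p : ℕ) (_ : p.Prime) (hpq : p ∣ q) : (p : ℝ) ≤ q := by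
    exact_mod_cast Nat.le_of_dvd (NeZero.pos q) hpq
  exact ⟨_, (Complex.continuous_re.tendsto _).comp
    (tendsto_ofReal_totient_mul_log_mertensProd_add_log_log ha hq)⟩

theorem totient_cast_ne_zero (q : ℕ) [NeZero q] : (q.totient : ℝ) ≠ 0 :=
  Nat.cast_ne_zero.2 (Nat.totient_pos.2 (NeZero.pos q)).ne'

theorem tendsto_mertensProd_mul_log_rpow_exp {R : ℝ}
    (hR : Tendsto (fun x : ℝ => (q.totient : ℝ) * Real.log (mertensProd q a x) +
      Real.log (Real.log x)) atTop (𝓝 R)) :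
    Tendsto (fun x : ℝ => mertensProd q a x * Real.log x ^ (1 / (q.totient : ℝ))) atTop
      (𝓝 (Real.exp (R / q.totient))) := by
  refine (hR.div_const (q.totient : ℝ)).rexp.congr' ?_
  filter_upwards [eventually_gt_atTop 1] with x hx
  rw [add_div, mul_div_cancel_left₀ _ (totient_cast_ne_zero q), Real.exp_add,
    Real.exp_log (mertensProd_pos q a x), Real.rpow_def_of_pos (Real.log_pos hx), mul_one_div]

theorem mertensConst_eq_exp {R : ℝ}
    (hR : Tendsto (fun x : ℝ => (q.totient : ℝ) * Real.log (mertensProd q a x) +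
      Real.log (Real.log x)) atTop (𝓝 R)) :
    mertensConst q a = Real.exp (R / q.totient) :=
  (tendsto_mertensProd_mul_log_rpow_exp hR).limUnder_eq

theorem mertensConst_pos (ha : IsCoprime a (q : ℤ)) : 0 < mertensConst q a := by
  obtain ⟨R, hR⟩ := exists_tendsto_totient_mul_log_mertensProd_add_log_log ha
  exact mertensConst_eq_exp hR ▸ Real.exp_pos _

theorem isEquivalent_mertensProd (ha : IsCoprime a (q : ℤ)) :
    mertensProd q a ~[atTop] fun x : ℝ =>
      mertensConst q a / Real.log x ^ (1 / (q.totient : ℝ)) := by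
  obtain ⟨R, hR⟩ := exists_tendsto_totient_mul_log_mertensProd_add_log_log ha
  have hlim := (tendsto_mertensProd_mul_log_rpow_exp hR).div_const (mertensConst q a)
  rw [← mertensConst_eq_exp hR, div_self (mertensConst_pos ha).ne'] at hlim
  refine isEquivalent_of_tendsto_one (hlim.congr fun x => ?_)
  rw [Pi.div_apply, div_div_eq_mul_div]

theorem tendsto_totient_mul_log_mertensProd_add_log_log (ha : IsCoprime a (q : ℤ)) :
    Tendsto (fun x : ℝ => (q.totient : ℝ) * Real.log (mertensProd q a x) +
      Real.log (Real.log x)) atTop (𝓝 (q.totient * Real.log (mertensConst q a))) := by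
  obtain ⟨R, hR⟩ := exists_tendsto_totient_mul_log_mertensProd_add_log_log ha
  rwa [mertensConst_eq_exp hR, Real.log_exp, mul_div_cancel₀ _ (totient_cast_ne_zero q)]

open scoped Classical in
theorem totient_mul_log_mertensConst (ha : IsCoprime a (q : ℤ)) {B : ℝ}
    (hB : ∀ p : ℕ, p.Prime → p ∣ q → (p : ℝ) ≤ B) :
    (((q.totient : ℝ) * Real.log (mertensConst q a) : ℝ) : ℂ) =
      -(Real.eulerMascheroniConstant : ℂ) +
        ((Real.log (∏ p ∈ primesUpTo B, (1 - 1 / (p : ℝ)) ^ mertensExp q a p) : ℝ) : ℂ) -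
        ∑ χ : DirichletCharacter ℂ q with χ ≠ 1, (starRingEnd ℂ) (χ (a : ZMod q)) *
          ∑' m : ℕ+, 1 / ((m : ℕ) : ℂ) * ∑' k : ℕ+, moebiusTerm χ B m k :=
  tendsto_nhds_unique (tendsto_totient_mul_log_mertensProd_add_log_log ha).ofReal
    (tendsto_ofReal_totient_mul_log_mertensProd_add_log_log ha hB)

end MertensConst

open scoped Classical in
theorem mainTheorem2 (q : ℕ) [NeZero q] (hq : 3 ≤ q) (a : ℤ) (ha : IsCoprime a (q : ℤ))
    (A : ℝ) (hA : 0 < A) (hAq : ∀ p : ℕ, p.Prime → p ∣ q → (p : ℝ) ≤ A * (q : ℝ)) :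
    -- the constant `C(q, a)` exists and is positive
    (0 < mertensConst q a ∧
      mertensProd q a ~[atTop]
        fun x : ℝ => mertensConst q a / (Real.log x) ^ (1 / (Nat.totient q : ℝ))) ∧
    -- the truncated Euler products and their logarithms converge
    (∀ χ : DirichletCharacter ℂ q, χ ≠ 1 → ∀ m k : ℕ+, ∀ s : ℂ,
      s = (((k : ℕ) * (m : ℕ) : ℕ) : ℂ) →
        Tendsto (eulerTailPartial (χ ^ (k : ℕ)) (A * q) s) atTop
          (𝓝 (eulerTail (χ ^ (k : ℕ)) (A * q) s)) ∧
        Tendsto (logEulerTailPartial (χ ^ (k : ℕ)) (A * q) s) atTop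
          (𝓝 (logEulerTail (χ ^ (k : ℕ)) (A * q) s)) ∧
        Complex.exp (logEulerTail (χ ^ (k : ℕ)) (A * q) s) =
          eulerTail (χ ^ (k : ℕ)) (A * q) s) ∧
    -- the inner and outer series converge
    (∀ χ : DirichletCharacter ℂ q, χ ≠ 1 →
      (∀ m : ℕ+, Summable fun k : ℕ+ => moebiusTerm χ (A * q) m k) ∧
      Summable fun m : ℕ+ => 1 / ((m : ℕ) : ℂ) * ∑' k : ℕ+, moebiusTerm χ (A * q) m k) ∧
    -- the formula
    (((Nat.totient q : ℝ) * Real.log (mertensConst q a) : ℝ) : ℂ) =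
      -(Real.eulerMascheroniConstant : ℂ)
      + ((Real.log (∏ p ∈ primesUpTo (A * q),
          (1 - 1 / (p : ℝ)) ^ mertensExp q a p) : ℝ) : ℂ)
      - ∑ χ : DirichletCharacter ℂ q with χ ≠ 1,
          (starRingEnd ℂ) (χ (a : ZMod q)) *
            ∑' m : ℕ+, 1 / ((m : ℕ) : ℂ) * ∑' k : ℕ+, moebiusTerm χ (A * q) m k := by
  refine ⟨⟨mertensConst_pos ha, isEquivalent_mertensProd ha⟩, ?_, fun χ hχ =>
    ⟨summable_moebiusTerm _ hχ, summable_one_div_mul_tsum_moebiusTerm _ hχ⟩,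
    totient_mul_log_mertensConst ha hAq⟩
  rintro χ hχ m k _ rfl
  exact ⟨tendsto_eulerTailPartial_pow _ hχ k m, tendsto_logEulerTailPartial_pow _ hχ k m,
    exp_logEulerTail_pow _ hχ k m⟩
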